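/- Let $f(x)=\frac12 x^TQx+p^Tx+r$ on $\mathbb{R}^d$ with $Q\in\mathbb{R}^{d\times d}$ symmetric positive definite, smallest eigenvalue $\mu$, largest eigenvalue $L$, eigenvalue decomposition $Q=U\Lambda U^T$, and minimizer $x_*$. Let $\alpha>0$, $\beta\ge 0$, $\nu\ge 0$ and consider the generalized momentum method (GMM) with gradient errors $w_k\in\mathbb{R}^d$, $$x_{k+1}=x_k-\alpha\big(\nabla f(y_k)+w_k\big)+\beta(x_k-x_{k-1}),\qquad y_k=x_k+\nu(x_k-x_{k-1}),\qquad k\ge 0,$$ with state $\xi_k=(x_k,x_{k-1})$. Its $\ell_2$ gain $L_{2,*}$ is the infimum of all $\gamma\ge 0$ for which there is a function $H:\mathbb{R}^{2d}\to[0,\infty)$ with $H(x_*,x_*)=0$ such that $$\sum_{k\ge 0}\big(f(x_k)-f(x_*)\big)\le\gamma^2\sum_{k\ge 0}\|w_k\|^2+H(\xi_0)$$ for every initialization $\xi_0\in\mathbb{R}^{2d}$ and every square-summable sequence $(w_k)$ (and $L_{2,*}=\infty$ if there is no such $\gamma$). Let $$A_Q=\begin{bmatrix}(1+\beta)I_d-\alpha(1+\nu)Q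 & -\beta I_d+\alpha\nu Q\\ I_d & 0_d\end{bmatrix},\quad B=\begin{bmatrix}-\alpha I_d\\ 0_d\end{bmatrix},\quad T=\begin{bmatrix}\tfrac1{\sqrt2}\Lambda^{1/2}U^T & 0_d\end{bmatrix},$$ $G(z)=T(zI-A_Q)^{-1}B$, and $H_\infty=\max_{z\in\mathbb{C},\,|z|=1}\|G(z)\|$ with the spectral norm $\|\cdot\|$. For $\lambda>0$ put $b_\lambda=\alpha\lambda(1+\nu)-(1+\beta)$, $c_\lambda=\beta-\alpha\lambda\nu$ and $$r_\lambda=\begin{cases}|1-c_\lambda|\sqrt{1-\frac{b_\lambda^2}{4c_\lambda}} & \text{if } c_\lambda>0 \text{ and } \frac{|b_\lambda|(1+c_\lambda)}{4c_\lambda}<1,\\[1mm] \big||1+c_\lambda|-|b_\lambda|\big| & \text{otherwise.}\end{cases}$$ Theorem. If the spectral radius satisfies $\rho(A_Q)<1$, then the maximum defining $H_\infty$ is attained, $r_\mu,r_L>0$, and $$L_{2,*}=H_\infty=\frac{\alpha}{\sqrt2}\max_{\lambda\in\{\mu,L\}}\frac{\sqrt\lambda}{r_\lambda}.$$ Furthermore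 $L_{2,*}=H_\infty\ge\frac1{\sqrt{2\mu}}$, and equality $L_{2,*}=H_\infty=\frac1{\sqrt{2\mu}}$ holds if and only if $(\alpha,\beta,\nu)\in\mathcal S_1\cap\mathcal S_2$, where $$\mathcal S_1=\{(\alpha,\beta,\nu): c_\mu\le 0\ \text{or}\ |b_\mu(1+c_\mu)|\ge 4|c_\mu|\},\qquad \mathcal S_2=\{(\alpha,\beta,\nu):\alpha\sqrt{L\mu}\le r_L\}.$$ -/

import Mathlib

open scoped ENNReal NNReal Matrix

noncomputable section

/-- The state `ξ_k = (x_k, x_{k-1})` of the generalized momentum method (GMM) run on `f` with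
inexact gradients `∇f(y_k) + w_k`, where `y_k = x_k + ν (x_k - x_{k-1})` and
`x_{k+1} = x_k - α (∇f(y_k) + w_k) + β (x_k - x_{k-1})`, started at `ξ₀ = (x_0, x_{-1})`. -/
def gmmState {E : Type*} [NormedAddCommGroup E] [InnerProductSpace ℝ E] [CompleteSpace E]
    (f : E → ℝ) (α β ν : ℝ) (w : ℕ → E) (ξ₀ : E × E) : ℕ → E × E
  | 0 => ξ₀
  | k + 1 =>
    let x := (gmmState f α β ν w ξ₀ k).1
    let xprev := (gmmState f α β ν w ξ₀ k).2
    let y := x + ν • (x - xprev)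
    (x - α • (gradient f y + w k) + β • (x - xprev), x)

/-- GMM on `f` (with minimizer `xs`) has `L₂` gain at most `γ`, from the square-summable gradient
errors `w` to an output `z` with `‖z_k‖² = f(x_k) - f(x_*)`: there is a nonnegative function `H`
of the initialization, vanishing at `ξ_* = (x_*, x_*)`, such that
`∑ (f(x_k) - f(x_*)) ≤ γ² ∑ ‖w_k‖² + H(ξ₀)` for all initializations `ξ₀` and all
square-summable `w` (in particular the left-hand series converges). -/
def HasL2GainLE {E : Type*} [NormedAddCommGroup E] [InnerProductSpace ℝ E] [CompleteSpace E]
    (f : E → ℝ) (xs : E) (α β ν : ℝ) (γ : ℝ≥0) : Prop :=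
  ∃ H : E × E → ℝ≥0, H (xs, xs) = 0 ∧
    ∀ (ξ₀ : E × E) (w : ℕ → E), Summable (fun k => ‖w k‖ ^ 2) →
      Summable (fun k => f (gmmState f α β ν w ξ₀ k).1 - f xs) ∧
      ∑' k, (f (gmmState f α β ν w ξ₀ k).1 - f xs) ≤
        (γ : ℝ) ^ 2 * ∑' k, ‖w k‖ ^ 2 + (H ξ₀ : ℝ)

/-- The `ℓ₂` gain `L_{2,*}`: the infimum of all `γ ≥ 0` such that the `L₂` gain is at most `γ`
(it is `∞` if there is no such `γ`). -/
def l2Gain {E : Type*} [NormedAddCommGroup E] [InnerProductSpace ℝ E] [CompleteSpace E]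
    (f : E → ℝ) (xs : E) (α β ν : ℝ) : ℝ≥0∞ :=
  ⨅ (γ : ℝ≥0) (_ : HasL2GainLE f xs α β ν γ), (γ : ℝ≥0∞)

/-- The transfer matrix `G(z) = T (z I - A)⁻¹ B` of the discrete-time linear system
`ξ_{k+1} = A ξ_k + B w_k`, `z_k = T ξ_k` with real matrices. -/
def transferMatrix {m n q : Type*} [Fintype n] [DecidableEq n]
    (A : Matrix n n ℝ) (B : Matrix n m ℝ) (T : Matrix q n ℝ) (z : ℂ) : Matrix q m ℂ :=
  T.map Complex.ofReal * (z • (1 : Matrix n n ℂ) - A.map Complex.ofReal)⁻¹ *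
    B.map Complex.ofReal

/-- The spectral norm (2-norm) of a complex matrix: its operator norm between Euclidean spaces. -/
def spectralNorm₂ {m : Type*} [Fintype m] [DecidableEq m] (M : Matrix m m ℂ) : ℝ :=
  ‖Matrix.toEuclideanCLM (𝕜 := ℂ) M‖

/-- The `H_∞` norm of the system `(A, B, T)`: the supremum of `‖G(z)‖` over `|z| = 1`. -/
def hInfNorm {m n : Type*} [Fintype m] [DecidableEq m] [Fintype n] [DecidableEq n]
    (A : Matrix n n ℝ) (B : Matrix n m ℝ) (T : Matrix m n ℝ) : ℝ≥0∞ :=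
  ⨆ (z : ℂ) (_ : ‖z‖ = 1), ENNReal.ofReal (spectralNorm₂ (transferMatrix A B T z))

/-- The quadratic `f(x) = ½ xᵀ Q x + pᵀ x + r`. -/
def quadObjective {d : ℕ} (Q : Matrix (Fin d) (Fin d) ℝ) (p : EuclideanSpace ℝ (Fin d)) (r : ℝ) :
    EuclideanSpace ℝ (Fin d) → ℝ :=
  fun x => (1 / 2) * (x.ofLp ⬝ᵥ (Q *ᵥ x.ofLp)) + p.ofLp ⬝ᵥ x.ofLp + r

/-- The iteration matrix `A_Q` of GMM on a quadratic with Hessian `Q`. -/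
def gmmA {d : ℕ} (Q : Matrix (Fin d) (Fin d) ℝ) (α β ν : ℝ) :
    Matrix (Fin d ⊕ Fin d) (Fin d ⊕ Fin d) ℝ :=
  Matrix.fromBlocks
    ((1 + β) • (1 : Matrix (Fin d) (Fin d) ℝ) - (α * (1 + ν)) • Q)
    (-(β • (1 : Matrix (Fin d) (Fin d) ℝ)) + (α * ν) • Q)
    1 0

/-- The input matrix `B = [-α I; 0]`. -/
def gmmB (d : ℕ) (α : ℝ) : Matrix (Fin d ⊕ Fin d) (Fin d) ℝ :=
  Matrix.fromRows (-(α • (1 : Matrix (Fin d) (Fin d) ℝ))) 0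

/-- The output matrix `T = [ (1/√2) Λ^{1/2} Uᵀ , 0 ]`, with `Λ = diag(lam)`. -/
def gmmT {d : ℕ} (U : Matrix (Fin d) (Fin d) ℝ) (lam : Fin d → ℝ) :
    Matrix (Fin d) (Fin d ⊕ Fin d) ℝ :=
  Matrix.fromCols
    ((1 / √2 : ℝ) • (Matrix.diagonal (fun i => √(lam i)) * Uᵀ)) 0

/-- `b_λ = α λ (1 + ν) - (1 + β)`. -/
def bCoef (α β ν lam : ℝ) : ℝ := α * lam * (1 + ν) - (1 + β)

/-- `c_λ = β - α λ ν`. -/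
def cCoef (α β ν lam : ℝ) : ℝ := β - α * lam * ν

open Classical in
/-- The quantity `r_λ`. -/
def rCoef (α β ν lam : ℝ) : ℝ :=
  if 0 < cCoef α β ν lam ∧
      |bCoef α β ν lam| * (1 + cCoef α β ν lam) / (4 * cCoef α β ν lam) < 1 then
    |1 - cCoef α β ν lam| * √(1 - bCoef α β ν lam ^ 2 / (4 * cCoef α β ν lam))
  else
    |(|1 + cCoef α β ν lam| - |bCoef α β ν lam|)|

/-- The set `S₁` of parameters `(α, β, ν)`. -/
def setS₁ (μ : ℝ) : Set (ℝ × ℝ × ℝ) :=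
  {θ | cCoef θ.1 θ.2.1 θ.2.2 μ ≤ 0 ∨
    4 * |cCoef θ.1 θ.2.1 θ.2.2 μ| ≤
      |bCoef θ.1 θ.2.1 θ.2.2 μ * (1 + cCoef θ.1 θ.2.1 θ.2.2 μ)|}

/-- The set `S₂` of parameters `(α, β, ν)`. -/
def setS₂ (μ L : ℝ) : Set (ℝ × ℝ × ℝ) :=
  {θ | θ.1 * √(L * μ) ≤ rCoef θ.1 θ.2.1 θ.2.2 L}

end

/-! In the eigenbasis of Q, centred at the minimizer, the method splits into scalar recurrences
x_{k+1} + b_λ x_k + c_λ x_{k-1} = -α ω_k. On |z| = 1 the mode λ has gain (α/√2) √λ / |z² + b_λ z +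
c_λ|, and the squared denominator `symbolSq` is a quadratic polynomial in t = Re z whose minimum
over [-1, 1] is r_λ² (`rCoef_spec`). This gives the H∞ norm as a maximum over all eigenvalues.

The ℓ₂ gain is the same maximum. For the upper bound, a decomposition of the symbol minus r_λ² into
nonnegative terms becomes, in the time domain, a dissipation inequality with a quadratic storage
function (`SymbolCertificate.exists_storage`). For the lower bound, truncated exponentials are fed
in along one eigenvector (`HasL2GainLE.mode_le`).

The hard point is that an extreme eigenvalue is the worst one (`mul_le_symbolSq_of_endpoints`). Put
s = αλ and minimize W(s, t)/s over a rectangle. On the sides t = ±1 this quotient is strictly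
monotone in s, and every interior critical point is a saddle (`symbolSq_div_saddle`), so the minimum
lies at an end of the s-range.

At z = 1 the symbol is (αλ)², so r_μ ≤ αμ, which is the lower bound 1/√(2μ). Equality means that
mode μ is worst at z = 1 and mode L is no worse. -/

/-! ### The symbol on the unit circle and the worst eigenvalue. -/

/-- The value of `|z² + b z + c|²` at a point of the unit circle with real part `t`. -/
def symbolSq (b c t : ℝ) : ℝ := 4 * c * t ^ 2 + 2 * b * (1 + c) * t + b ^ 2 + (1 - c) ^ 2

/-- First- and second-order necessary conditions at a minimum; the function used later is exactly
cubic along lines, so no remainder estimate is needed. -/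
theorem cubic_nonneg_near_zero {a₁ a₂ a₃ ε : ℝ} (hε : 0 < ε)
    (h : ∀ τ : ℝ, |τ| ≤ ε → 0 ≤ a₁ * τ + a₂ * τ ^ 2 + a₃ * τ ^ 3) : a₁ = 0 ∧ 0 ≤ a₂ := by
  have key : ∀ x : ℝ, ∀ y : ℝ, (∀ δ : ℝ, 0 < δ → δ ≤ ε → 0 ≤ x + y * δ) → 0 ≤ x := by
    intro x y hxy
    by_contra! hx
    have hy : 0 < |y| + 1 := by positivity
    have hδ : 0 < min ε (-x / (2 * (|y| + 1))) :=
      lt_min hε (div_pos (by linarith) (by positivity))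
    have h1 := hxy _ hδ (min_le_left _ _)
    have h2 : min ε (-x / (2 * (|y| + 1))) ≤ -x / (2 * (|y| + 1)) := min_le_right _ _
    set δ := min ε (-x / (2 * (|y| + 1)))
    rw [le_div_iff₀ (by positivity)] at h2
    nlinarith [mul_le_mul_of_nonneg_right (le_abs_self y) hδ.le]
  have hb : ∀ σ : ℝ, σ ^ 2 = 1 → 0 ≤ σ * a₁ := by
    intro σ hσ
    -- After division by δ ≤ ε, the terms beyond σ a₁ are at most (|a₂| + |a₃| ε) δ.
    refine key _ (|a₂| + |a₃| * ε) fun δ hδ hδε => ?_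
    have hs : |σ| = 1 := by
      rw [← sq_abs] at hσ; nlinarith [abs_nonneg σ]
    have h1 := h (σ * δ) (by rw [abs_mul, hs, one_mul, abs_of_pos hδ]; exact hδε)
    have e : a₁ * (σ * δ) + a₂ * (σ * δ) ^ 2 + a₃ * (σ * δ) ^ 3
        = δ * (σ * a₁ + a₂ * δ + σ * a₃ * δ * δ) := by
      linear_combination (a₂ * δ ^ 2 + a₃ * σ * δ ^ 3) * hσ
    rw [e] at h1
    have h2 := nonneg_of_mul_nonneg_right h1 hδ
    have h3 : σ * a₃ ≤ |a₃| := by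
      calc σ * a₃ ≤ |σ * a₃| := le_abs_self _
        _ = |a₃| := by rw [abs_mul, hs, one_mul]
    have h4 : σ * a₃ * (δ * δ) ≤ |a₃| * (ε * δ) := by
      have : |a₃| * (δ * δ) ≤ |a₃| * (ε * δ) := by gcongr
      nlinarith [mul_pos hδ hδ]
    nlinarith [le_abs_self a₂]
  have h0 : a₁ = 0 := by
    have h1 := hb 1 (by norm_num)
    have h2 := hb (-1) (by norm_num)
    linarith
  refine ⟨h0, key _ a₃ fun δ hδ hδε => ?_⟩
  have h1 := h δ (by rwa [abs_of_pos hδ])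
  have e : a₁ * δ + a₂ * δ ^ 2 + a₃ * δ ^ 3 = δ ^ 2 * (a₂ + a₃ * δ) := by rw [h0]; ring
  rw [e] at h1
  exact nonneg_of_mul_nonneg_right h1 (by positivity)

/-- The stationarity relation `hX` determines ν. After multiplication by a square, the Hessian
discriminant is a polynomial in ν S D, so ν can be eliminated. -/
theorem hessian_identity {c e ν : ℝ}
    (hX : ν * (1 + c + c * e) * ((2 - e) * (4 + e * (1 + c)))
      = (1 - c) * ((e + 2) * (2 + c * e))) :
    ((1 + c + c * e) * ((2 - e) * (4 + e * (1 + c)))) ^ 2 *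
      ((ν * e + (1 + ν) * (1 + c)) ^ 2
        - 4 * c * (1 + 2 * ν * (1 + ν) * (1 - -(e * (1 + c)) / 4)))
      = (1 - c) ^ 2 * ((12 + 4 * c + (4 + 12 * c) * e + (1 + c + 2 * c ^ 2) * e ^ 2) ^ 2
        - c * ((2 + c) * e ^ 2 + 4) * ((e + 2) * (2 + c * e)) ^ 2) := by
  have e1 : ∀ S D : ℝ, (S * D) ^ 2 * ((ν * e + (1 + ν) * (1 + c)) ^ 2
      - 4 * c * (1 + 2 * ν * (1 + ν) * (1 - -(e * (1 + c)) / 4)))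
      = ((ν * S * D) * (e + 1 + c) + (1 + c) * S * D) ^ 2
        - 4 * c * ((S * D) ^ 2 + 2 * (ν * S * D) * (S * D + ν * S * D) *
          (1 - -(e * (1 + c)) / 4)) := fun S D => by ring
  rw [e1, hX]
  ring

/-- At a joint critical point of `(s, t) ↦ W(s, t) / s`, where `W(s, t) = symbolSq b c t` with
`c = β - ν s` and `b = s - 1 - c`, the Hessian is indefinite. -/
theorem symbolSq_div_saddle {c s b t ν : ℝ} (hc : 0 < c) (hc1 : c < 1) (hs : 0 < s) (hν : 0 ≤ ν)
    (ht : t < 1) (hb : b = s - 1 - c) (hcrit : 4 * c * t = -(b * (1 + c)))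
    (hstat : s * (-4 * ν * t ^ 2 + 2 * (1 + ν) * (1 + c) * t - 2 * b * ν * t + 2 * b * (1 + ν)
      + 2 * (1 - c) * ν) = symbolSq b c t) :
    16 * c * (1 + 2 * ν * (1 + ν) * (1 - t)) <
      (-8 * ν * t + 2 * (1 + ν) * (1 + c) - 2 * b * ν) ^ 2 := by
  -- With e = b/c, both s and t become explicit in c and e, and stationarity in s becomes a linear
  -- equation for ν. Its sign, with ν ≥ 0, then confines e to [-2, 2).
  obtain ⟨e, rfl⟩ : ∃ e, b = c * e := ⟨b / c, by field_simp⟩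
  obtain rfl : s = 1 + c + c * e := by linarith
  obtain rfl : t = -(e * (1 + c)) / 4 := by
    have : c * (4 * t + e * (1 + c)) = 0 := by linear_combination hcrit
    rcases mul_eq_zero.1 this with h | h
    · exact absurd h hc.ne'
    · linarith
  have ha : 0 < 1 - c := by linarith
  have h4 : 0 < 4 + e * (1 + c) := by linarith
  have hX : ν * (1 + c + c * e) * ((2 - e) * (4 + e * (1 + c)))
      = (1 - c) * ((e + 2) * (2 + c * e)) := by
    have h : (1 - c) * ((1 - c) * ((e + 2) * (2 + c * e))
        - ν * (1 + c + c * e) * ((2 - e) * (4 + e * (1 + c)))) = 0 := by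
      unfold symbolSq at hstat
      linear_combination (-4) * hstat
    rcases mul_eq_zero.1 h with h | h
    · exact absurd h ha.ne'
    · linarith
  have h2c : 0 < 2 + c * e := by linarith
  have hn : 0 ≤ ν * (1 + c + c * e) := by positivity
  have he2 : e < 2 := by
    by_contra! h
    have h1 : 0 < (1 - c) * ((e + 2) * (2 + c * e)) := by
      have : 0 < e + 2 := by linarith
      positivity
    have h3 : ν * (1 + c + c * e) * ((2 - e) * (4 + e * (1 + c))) ≤ 0 :=
      mul_nonpos_of_nonneg_of_nonpos hn (mul_nonpos_of_nonpos_of_nonneg (by linarith) h4.le)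
    linarith
  have hem : -2 ≤ e := by
    by_contra! h
    have h1 : (1 - c) * ((e + 2) * (2 + c * e)) < 0 :=
      mul_neg_of_pos_of_neg ha (mul_neg_of_neg_of_pos (by linarith) h2c)
    have h3 : 0 ≤ ν * (1 + c + c * e) * ((2 - e) * (4 + e * (1 + c))) :=
      mul_nonneg hn (mul_nonneg (by linarith) h4.le)
    linarith
  have hD : 0 < (2 - e) * (4 + e * (1 + c)) := mul_pos (by linarith) h4
  set M := (e + 2) * (2 + c * e) with hM
  have hM0 : 0 ≤ M := mul_nonneg (by linarith) h2c.le
  set Y := 12 + 4 * c + (4 + 12 * c) * e + (1 + c + 2 * c ^ 2) * e ^ 2 with hY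
  -- The slope (3 + 5c)/2 works because ((3 + 5c)/2)² - 4c(3 + c) = 9(1 - c)²/4, and e² ≤ 4 bounds
  -- c((2 + c)e² + 4) by 4c(3 + c).
  have hYM : (3 + 5 * c) / 2 * M < Y := by
    have e1 : Y - (3 + 5 * c) / 2 * M = (1 - c) * (6 + (1 + 5 * c) * e + (1 + c / 2) * e ^ 2) := by
      rw [hY, hM]; ring
    have e2 : 0 < 6 + (1 + 5 * c) * e + (1 + c / 2) * e ^ 2 := by
      have : 0 < (4 + 2 * c) * (6 + (1 + 5 * c) * e + (1 + c / 2) * e ^ 2) := by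
        nlinarith [sq_nonneg ((2 + c) * e + (1 + 5 * c)), mul_pos ha hc]
      exact pos_of_mul_pos_right this (by linarith)
    nlinarith [mul_pos ha e2]
  have hpos : 0 < Y ^ 2 - c * ((2 + c) * e ^ 2 + 4) * M ^ 2 := by
    have h1 : ((3 + 5 * c) / 2 * M) ^ 2 < Y ^ 2 :=
      pow_lt_pow_left₀ hYM (by positivity) two_ne_zero
    have he : e ^ 2 ≤ 4 := by nlinarith
    have h3 : c * ((2 + c) * e ^ 2 + 4) ≤ ((3 + 5 * c) / 2) ^ 2 := by
      have : c * (2 + c) * e ^ 2 ≤ c * (2 + c) * 4 := by gcongr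
      nlinarith [sq_nonneg (1 - c)]
    rw [mul_pow] at h1
    exact sub_pos.2 ((mul_le_mul_of_nonneg_right h3 (sq_nonneg M)).trans_lt h1)
  have hfin : ((1 + c + c * e) * ((2 - e) * (4 + e * (1 + c)))) ^ 2 *
      ((ν * e + (1 + ν) * (1 + c)) ^ 2
        - 4 * c * (1 + 2 * ν * (1 + ν) * (1 - -(e * (1 + c)) / 4)))
      = (1 - c) ^ 2 * (Y ^ 2 - c * ((2 + c) * e ^ 2 + 4) * M ^ 2) :=
    hessian_identity hX
  have h5 : 0 < (ν * e + (1 + ν) * (1 + c)) ^ 2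
        - 4 * c * (1 + 2 * ν * (1 + ν) * (1 - -(e * (1 + c)) / 4)) := by
    refine pos_of_mul_pos_right (hfin ▸ mul_pos (pow_pos ha 2) hpos) (sq_nonneg _)
  linear_combination 4 * h5

/-- If `κ s ≤ symbolSq b c t` on `[-1, 1]` at the two ends of a segment of stable parameters
`s ↦ (b, c) = (s (1 + ν) - (1 + β), β - s ν)`, the same holds inside the segment. -/
theorem mul_le_symbolSq_of_endpoints {β ν s₁ s₂ s κ t : ℝ} (hν : 0 ≤ ν) (hs₁ : 0 < s₁)
    (h₁ : s₁ ≤ s) (h₂ : s ≤ s₂) (hc₁ : β - s₁ * ν < 1) (hb₂ : s₂ < 2 * (1 + (β - s₂ * ν)))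
    (hκ₁ : ∀ t ∈ Set.Icc (-1 : ℝ) 1, κ * s₁ ≤ symbolSq (s₁ * (1 + ν) - (1 + β)) (β - s₁ * ν) t)
    (hκ₂ : ∀ t ∈ Set.Icc (-1 : ℝ) 1, κ * s₂ ≤ symbolSq (s₂ * (1 + ν) - (1 + β)) (β - s₂ * ν) t)
    (ht : t ∈ Set.Icc (-1 : ℝ) 1) :
    κ * s ≤ symbolSq (s * (1 + ν) - (1 + β)) (β - s * ν) t := by
  by_contra! hlt
  let W : ℝ → ℝ → ℝ := fun s t => symbolSq (s * (1 + ν) - (1 + β)) (β - s * ν) t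
  have hcont : ContinuousOn (fun q : ℝ × ℝ => W q.1 q.2 / q.1)
      (Set.Icc s₁ s₂ ×ˢ Set.Icc (-1 : ℝ) 1) := by
    refine ContinuousOn.div ?_ continuousOn_fst fun q hq => (hs₁.trans_le hq.1.1).ne'
    unfold W symbolSq
    fun_prop
  obtain ⟨⟨σ, τ⟩, ⟨hσ, hτ⟩, hmin⟩ := (isCompact_Icc.prod isCompact_Icc).exists_isMinOn
    ⟨(s, t), ⟨h₁, h₂⟩, ht⟩ hcont
  simp only at hσ hτ
  have hσ0 : 0 < σ := hs₁.trans_le hσ.1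
  have hs0 : 0 < s := hs₁.trans_le h₁
  have hs₂ : 0 < s₂ := hs0.trans_le h₂
  set κ' := W σ τ / σ with hκ'
  -- Clearing the denominator makes W - κ' s a nonnegative polynomial on the rectangle that vanishes
  -- at (σ, τ).
  have hmin' : ∀ x ∈ Set.Icc s₁ s₂, ∀ y ∈ Set.Icc (-1 : ℝ) 1, κ' * x ≤ W x y := by
    intro x hx y hy
    have h : W σ τ / σ ≤ W x y / x := hmin (a := (x, y)) ⟨hx, hy⟩
    rwa [le_div_iff₀ (hs₁.trans_le hx.1)] at h
  have heq : κ' * σ = W σ τ := by rw [hκ']; field_simp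
  have hκκ : κ' < κ := by
    have h := hmin' s ⟨h₁, h₂⟩ t ht
    exact lt_of_mul_lt_mul_right (h.trans_lt hlt) hs0.le
  have hσ₁ : s₁ < σ := by
    refine lt_of_le_of_ne hσ.1 ?_
    rintro rfl
    have := hκ₁ τ hτ
    change _ ≤ W _ _ at this
    rw [← heq] at this
    nlinarith
  have hσ₂ : σ < s₂ := by
    refine lt_of_le_of_ne hσ.2 ?_
    rintro rfl
    have := hκ₂ τ hτ
    change _ ≤ W _ _ at this
    rw [← heq] at this
    nlinarith
  have hW1 : ∀ x, W x 1 = x ^ 2 := fun x => by simp only [W, symbolSq]; ring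
  have hWm : ∀ x, W x (-1) = (2 * (1 + (β - x * ν)) - x) ^ 2 := fun x => by
    simp only [W, symbolSq]; ring
  -- W(s, 1)/s = s would be smaller at s₁.
  have hne1 : W σ τ ≠ W σ 1 := by
    intro h
    have h3 := hmin' s₁ ⟨le_rfl, h₁.trans h₂⟩ 1 ⟨by norm_num, le_rfl⟩
    rw [hW1] at h3
    rw [hW1, ← heq] at h
    have h5 : κ' = σ := by
      have : κ' * σ = σ * σ := by rw [h]; ring
      exact mul_right_cancel₀ hσ0.ne' this
    nlinarith
  -- At t = -1, W is the square of a quantity that decreases in s and is still positive at s₂, so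
  -- W/s would be smaller at s₂.
  have hnem : W σ τ ≠ W σ (-1) := by
    intro h
    have h3 := hmin' s₂ ⟨h₁.trans h₂, le_rfl⟩ (-1) ⟨le_rfl, by norm_num⟩
    rw [hWm] at h3
    rw [hWm, ← heq] at h
    have h5 : 2 * (1 + (β - s₂ * ν)) - s₂ < 2 * (1 + (β - σ * ν)) - σ := by nlinarith
    have h6 : (2 * (1 + (β - s₂ * ν)) - s₂) ^ 2 < (2 * (1 + (β - σ * ν)) - σ) ^ 2 :=
      pow_lt_pow_left₀ h5 (by linarith) two_ne_zero
    have h7 : 0 ≤ κ' := by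
      by_contra! h8
      nlinarith [sq_nonneg (2 * (1 + (β - σ * ν)) - σ)]
    nlinarith
  have hτ1 : τ < 1 := lt_of_le_of_ne hτ.2 fun h => hne1 (by rw [h])
  have hτm : -1 < τ := lt_of_le_of_ne hτ.1 fun h => hnem (by rw [← h])
  set c := β - σ * ν with hc
  set b := σ * (1 + ν) - (1 + β) with hb
  -- Vanishing gradient and nonnegative Hessian form of W - κ' s at (σ, τ), along an arbitrary
  -- direction (h, k).
  have hexp : ∀ h k : ℝ,
      (h * (-4 * ν * τ ^ 2 + 2 * (1 + ν) * (1 + c) * τ - 2 * b * ν * τ + 2 * b * (1 + ν)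
        + 2 * (1 - c) * ν - κ') + k * (8 * c * τ + 2 * b * (1 + c)) = 0) ∧
      0 ≤ (1 + 2 * ν * (1 + ν) * (1 - τ)) * h ^ 2
        + (-8 * ν * τ + 2 * (1 + ν) * (1 + c) - 2 * b * ν) * (h * k) + 4 * c * k ^ 2 := by
    intro h k
    have hev : ∀ᶠ ε in nhds (0 : ℝ), (σ + ε * h ∈ Set.Ioo s₁ s₂) ∧
        (τ + ε * k ∈ Set.Ioo (-1 : ℝ) 1) := by
      refine Filter.Eventually.and ?_ ?_
      · have : Filter.Tendsto (fun ε : ℝ => σ + ε * h) (nhds 0) (nhds (σ + 0 * h)) :=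
          Continuous.tendsto (by fun_prop) 0
        rw [zero_mul, add_zero] at this
        exact this (Ioo_mem_nhds hσ₁ hσ₂)
      · have : Filter.Tendsto (fun ε : ℝ => τ + ε * k) (nhds 0) (nhds (τ + 0 * k)) :=
          Continuous.tendsto (by fun_prop) 0
        rw [zero_mul, add_zero] at this
        exact this (Ioo_mem_nhds hτm hτ1)
    obtain ⟨ε, hε, hball⟩ := Metric.eventually_nhds_iff.1 hev
    refine cubic_nonneg_near_zero (a₃ := -4 * ν * h * k ^ 2 - 2 * ν * (1 + ν) * h ^ 2 * k)
      (half_pos hε) fun δ hδ => ?_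
    obtain ⟨hx, hy⟩ := hball (y := δ) (by
      rw [Real.dist_eq, sub_zero]; linarith)
    have h1 := hmin' _ (Set.Ioo_subset_Icc_self hx) _ (Set.Ioo_subset_Icc_self hy)
    have h2 : W (σ + δ * h) (τ + δ * k) - κ' * (σ + δ * h)
        - (W σ τ - κ' * σ) = 
        (h * (-4 * ν * τ ^ 2 + 2 * (1 + ν) * (1 + c) * τ - 2 * b * ν * τ + 2 * b * (1 + ν)
        + 2 * (1 - c) * ν - κ') + k * (8 * c * τ + 2 * b * (1 + c))) * δ +
        ((1 + 2 * ν * (1 + ν) * (1 - τ)) * h ^ 2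
        + (-8 * ν * τ + 2 * (1 + ν) * (1 + c) - 2 * b * ν) * (h * k) + 4 * c * k ^ 2) * δ ^ 2
        + (-4 * ν * h * k ^ 2 - 2 * ν * (1 + ν) * h ^ 2 * k) * δ ^ 3 := by
      simp only [W, symbolSq, hc, hb]
      ring
    rw [← h2]
    linarith
  have hbs : b = σ - 1 - c := by rw [hb, hc]; ring
  have hcrit : 8 * c * τ + 2 * b * (1 + c) = 0 := by simpa using (hexp 0 1).1
  have hstat := (hexp 1 0).1
  have hc0 : 0 ≤ c := by have := (hexp 0 1).2; linarith
  have hcpos : 0 < c := by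
    refine lt_of_le_of_ne hc0 fun h => hne1 ?_
    rw [← h] at hcrit
    have hb0 : b = 0 := by linarith
    change symbolSq b c τ = symbolSq b c 1
    rw [← h, hb0]
    simp [symbolSq]
  have hc1 : c < 1 := by rw [hc]; nlinarith
  have hsad := symbolSq_div_saddle (t := τ) hcpos hc1 hσ0 hν hτ1 hbs (by linarith) (by
    change _ = W σ τ
    rw [← heq]
    linear_combination σ * hstat)
  set p := -8 * ν * τ + 2 * (1 + ν) * (1 + c) - 2 * b * ν
  -- For fixed h this ratio k/h = -p/(8c) minimizes the Hessian form, whose value is then 4c times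
  -- the negative of the saddle discriminant.
  have hq := (hexp (8 * c) (-p)).2
  have : 0 ≤ 4 * c * (16 * c * (1 + 2 * ν * (1 + ν) * (1 - τ)) - p ^ 2) := by
    linarith
  have h9 := nonneg_of_mul_nonneg_right this (by linarith)
  linarith

/-! ### Certificates for the minimum of the symbol. -/

/-- A Fejér–Riesz type certificate that `symbolSq b c t - ρ` is nonnegative on `[-1, 1]`:
the difference is `4 c₁ (t - τ)² + 2 c₂ (1 - σ t) + 4 c₃ (1 - t²)`. -/
def SymbolCertificate (b c ρ τ σ c₁ c₂ c₃ : ℝ) : Prop :=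
  0 ≤ c₁ ∧ 0 ≤ c₂ ∧ 0 ≤ c₃ ∧ σ ^ 2 = 1 ∧ c = c₁ - c₃ ∧ b * (1 + c) = -4 * τ * c₁ - σ * c₂ ∧
    1 + b ^ 2 + c ^ 2 - ρ = c₁ * (2 + 4 * τ ^ 2) + 2 * c₂ + 2 * c₃

theorem SymbolCertificate.le {b c ρ τ σ c₁ c₂ c₃ t : ℝ}
    (h : SymbolCertificate b c ρ τ σ c₁ c₂ c₃) (ht : t ∈ Set.Icc (-1 : ℝ) 1) :
    ρ ≤ symbolSq b c t := by
  obtain ⟨h1, h2, h3, hσ, hc, hb, hρ⟩ := h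
  have e : symbolSq b c t - ρ
      = 4 * (c₁ * (t - τ) ^ 2) + 2 * (c₂ * (1 - σ * t)) + 4 * (c₃ * (1 - t ^ 2)) := by
    unfold symbolSq
    linear_combination (4 * t ^ 2 - 2) * hc + 2 * t * hb + hρ
  have hσt : 0 ≤ 1 - σ * t := by
    have := ht.1
    have := ht.2
    rcases (sq_eq_sq_iff_eq_or_eq_neg.1 (hσ.trans (one_pow 2).symm)) with h | h <;> rw [h] <;> linarith
  have ht2 : 0 ≤ 1 - t ^ 2 := by nlinarith [ht.1, ht.2]
  have := mul_nonneg h1 (sq_nonneg (t - τ))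
  have := mul_nonneg h2 hσt
  have := mul_nonneg h3 ht2
  linarith

/-- The two branches of r_λ say where the quadratic in t is smallest: at an interior vertex -b(1 +
c)/(4c) when c > 0, otherwise at the endpoint σ opposite in sign to b. The certificate has c₁ = c
for a convex parabola, c₃ = -c for a concave one, and c₂ absorbs the slope at the endpoint. -/
theorem rCoef_spec {α β ν lam b c : ℝ} (hb : bCoef α β ν lam = b) (hc : cCoef α β ν lam = c)
    (hc1 : c < 1) (hbc : |b| < 1 + c) :
    0 < rCoef α β ν lam ∧
    (∃ τ σ c₁ c₂ c₃, SymbolCertificate b c (rCoef α β ν lam ^ 2) τ σ c₁ c₂ c₃) ∧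
    ∃ t ∈ Set.Icc (-1 : ℝ) 1, symbolSq b c t = rCoef α β ν lam ^ 2 := by
  have h1c : 0 < 1 + c := (abs_nonneg b).trans_lt hbc
  unfold rCoef
  rw [hb, hc]
  split_ifs with h
  · obtain ⟨hc0, hlt⟩ := h
    rw [div_lt_one (by positivity)] at hlt
    have hb4 : b ^ 2 < 4 * c := by
      have h1 : (|b| * (1 + c)) ^ 2 < (4 * c) ^ 2 := pow_lt_pow_left₀ hlt (by positivity) two_ne_zero
      rw [mul_pow, sq_abs] at h1
      have h2 : 4 * c * b ^ 2 ≤ b ^ 2 * (1 + c) ^ 2 := by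
        nlinarith [mul_nonneg (sq_nonneg b) (sq_nonneg (1 - c))]
      have h3 : 4 * c * b ^ 2 < 4 * c * (4 * c) := by nlinarith
      exact lt_of_mul_lt_mul_left h3 (by positivity)
    have hpos : 0 < 1 - b ^ 2 / (4 * c) := by
      rw [sub_pos, div_lt_one (by positivity)]; exact hb4
    have hsq : (|1 - c| * √(1 - b ^ 2 / (4 * c))) ^ 2 = (1 - c) ^ 2 * (1 - b ^ 2 / (4 * c)) := by
      rw [mul_pow, sq_abs, Real.sq_sqrt hpos.le]
    rw [hsq]
    refine ⟨mul_pos (abs_pos.2 (by linarith)) (Real.sqrt_pos.2 hpos),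
      ⟨-(b * (1 + c)) / (4 * c), 1, c, 0, 0, hc0.le, le_rfl, le_rfl, by norm_num, by ring, ?_, ?_⟩,
      -(b * (1 + c)) / (4 * c), ?_, ?_⟩
    · field_simp; ring
    · field_simp; ring
    · rw [Set.mem_Icc, ← abs_le, abs_div, abs_neg, abs_mul, abs_of_pos h1c,
        abs_of_pos (show 0 < 4 * c by positivity), div_le_one (by positivity)]
      exact hlt.le
    · unfold symbolSq; field_simp; ring
  · have hr : |(|1 + c| - |b|)| = 1 + c - |b| := by
      rw [abs_of_pos h1c, abs_of_pos (by linarith)]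
    rw [hr]
    obtain ⟨σ, hσ, hσb⟩ : ∃ σ : ℝ, σ ^ 2 = 1 ∧ b = -(σ * |b|) := by
      rcases le_total 0 b with h | h
      · exact ⟨-1, by norm_num, by rw [abs_of_nonneg h]; ring⟩
      · exact ⟨1, by norm_num, by rw [abs_of_nonpos h]; ring⟩
    have hbb : b ^ 2 = |b| ^ 2 := (sq_abs b).symm
    refine ⟨by linarith, ?_, σ, ?_, ?_⟩
    · rcases le_or_gt c 0 with hc0 | hc0
      · refine ⟨0, σ, 0, |b| * (1 + c), -c, le_rfl, by positivity, by linarith, hσ, by ring, ?_, ?_⟩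
        · linear_combination (1 + c) * hσb
        · linear_combination hbb
      · have h4 : 4 * c ≤ |b| * (1 + c) := by
          by_contra! h4
          exact h ⟨hc0, (div_lt_one (by positivity)).2 h4⟩
        refine ⟨σ, σ, c, |b| * (1 + c) - 4 * c, 0, hc0.le, by linarith, le_rfl, hσ, by ring, ?_, ?_⟩
        · linear_combination (1 + c) * hσb
        · linear_combination hbb - 4 * c * hσ
    · rw [Set.mem_Icc, ← abs_le]
      rw [← sq_abs] at hσ
      nlinarith [abs_nonneg σ]
    · unfold symbolSq
      linear_combination (4 * c - 2 * (1 + c) * |b|) * hσ + hbb + 2 * (1 + c) * σ * hσb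

theorem Complex.norm_sq_quadratic {b c : ℝ} {z : ℂ} (hz : ‖z‖ = 1) :
    ‖z ^ 2 + b * z + c‖ ^ 2 = symbolSq b c z.re := by
  have h : z.re ^ 2 + z.im ^ 2 = 1 := by
    have := Complex.sq_norm z
    rw [hz, Complex.normSq_apply] at this
    linarith
  rw [Complex.sq_norm, Complex.normSq_apply]
  simp only [symbolSq, pow_two, Complex.add_re, Complex.mul_re, Complex.ofReal_re,
    Complex.ofReal_im, Complex.add_im, Complex.mul_im]
  have e : z.im ^ 2 = 1 - z.re ^ 2 := by linarith
  have e4 : z.im ^ 4 = (1 - z.re ^ 2) ^ 2 := by rw [← e]; ring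
  ring_nf
  simp only [e, e4]
  ring

theorem exists_norm_eq_one_re {t : ℝ} (ht : t ∈ Set.Icc (-1 : ℝ) 1) :
    ∃ z : ℂ, ‖z‖ = 1 ∧ z.re = t := by
  refine ⟨⟨t, √(1 - t ^ 2)⟩, ?_, rfl⟩
  have h : 0 ≤ 1 - t ^ 2 := by nlinarith [ht.1, ht.2]
  have : ‖(⟨t, √(1 - t ^ 2)⟩ : ℂ)‖ ^ 2 = 1 := by
    rw [Complex.sq_norm, Complex.normSq_apply]
    simp only [Real.mul_self_sqrt h]
    ring
  exact (pow_eq_one_iff_of_nonneg (norm_nonneg _) two_ne_zero).1 this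

/-! ### Scalar recurrences in the time domain. -/

/-- A first-order stable recurrence with square-summable input has a square-summable output. -/
theorem summable_sq_of_recurrence {ρ : ℂ} (hρ : ‖ρ‖ < 1) {y u : ℕ → ℂ}
    (h : ∀ k, y (k + 1) = ρ * y k + u k) (hu : Summable fun k => ‖u k‖ ^ 2) :
    Summable fun k => ‖y k‖ ^ 2 := by
  set q := ‖ρ‖
  have hq : 0 < 1 - q := by linarith
  have hq0 : 0 ≤ q := norm_nonneg ρ
  -- Convexity of the square at the average q·‖y‖ + (1 - q)·(‖u‖/(1 - q)).
  have hstep : ∀ k, ‖y (k + 1)‖ ^ 2 ≤ q * ‖y k‖ ^ 2 + ‖u k‖ ^ 2 / (1 - q) := by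
    intro k
    have h1 : ‖y (k + 1)‖ ≤ q * ‖y k‖ + ‖u k‖ := by
      rw [h k]
      exact (norm_add_le _ _).trans (by rw [norm_mul])
    refine (pow_le_pow_left₀ (norm_nonneg _) h1 2).trans ?_
    have e : q * ‖y k‖ ^ 2 + ‖u k‖ ^ 2 / (1 - q) - (q * ‖y k‖ + ‖u k‖) ^ 2
        = q / (1 - q) * ((1 - q) * ‖y k‖ - ‖u k‖) ^ 2 := by
      field_simp; ring
    have : 0 ≤ q / (1 - q) * ((1 - q) * ‖y k‖ - ‖u k‖) ^ 2 := by positivity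
    linarith
  refine summable_of_sum_range_le (c := (‖y 0‖ ^ 2 + (∑' k, ‖u k‖ ^ 2) / (1 - q)) / (1 - q))
    (fun _ => by positivity) fun n => ?_
  have h1 : ∑ k ∈ Finset.range n, ‖y k‖ ^ 2 ≤ ∑ k ∈ Finset.range (n + 1), ‖y k‖ ^ 2 :=
    Finset.sum_le_sum_of_subset_of_nonneg (Finset.range_mono n.le_succ)
      fun _ _ _ => by positivity
  have h2 : ∑ k ∈ Finset.range n, ‖u k‖ ^ 2 ≤ ∑' k, ‖u k‖ ^ 2 :=
    hu.sum_le_tsum _ fun _ _ => by positivity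
  rw [Finset.sum_range_succ'] at h1
  have h3 : ∑ k ∈ Finset.range n, ‖y (k + 1)‖ ^ 2
      ≤ q * ∑ k ∈ Finset.range n, ‖y k‖ ^ 2 + (∑ k ∈ Finset.range n, ‖u k‖ ^ 2) / (1 - q) := by
    rw [Finset.mul_sum, Finset.sum_div, ← Finset.sum_add_distrib]
    exact Finset.sum_le_sum fun k _ => hstep k
  have h4 : (∑ k ∈ Finset.range n, ‖u k‖ ^ 2) / (1 - q) ≤ (∑' k, ‖u k‖ ^ 2) / (1 - q) := by
    gcongr
  rw [le_div_iff₀ hq]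
  linarith

/-- A second-order recurrence whose characteristic roots lie in the open unit disk has a
square-summable solution for square-summable inputs. -/
theorem summable_sq_of_recurrence_two {b c : ℝ} (hroots : ∀ z : ℂ, z ^ 2 + b * z + c = 0 → ‖z‖ < 1)
    {x y u : ℕ → ℝ} (hy : ∀ k, y (k + 1) = x k) (hx : ∀ k, x (k + 1) = -b * x k - c * y k + u k)
    (hu : Summable fun k => u k ^ 2) : Summable fun k => x k ^ 2 := by
  obtain ⟨s, hs⟩ := IsSquare.exists_sq ((b : ℂ) ^ 2 - 4 * c) (IsAlgClosed.exists_pow_nat_eq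
    ((b : ℂ) ^ 2 - 4 * c) (n := 2) (by norm_num) |>.elim fun s h => ⟨s, by rw [← h, pow_two]⟩)
  set z₁ := (-b + s) / 2 with hz₁
  set z₂ := (-b - s) / 2 with hz₂
  have h₁ : ‖z₁‖ < 1 := hroots _ (by rw [hz₁]; linear_combination (-1 / 4 : ℂ) * hs)
  have h₂ : ‖z₂‖ < 1 := hroots _ (by rw [hz₂]; linear_combination (-1 / 4 : ℂ) * hs)
  have hsum : z₁ + z₂ = -b := by rw [hz₁, hz₂]; ring
  have hprod : z₁ * z₂ = c := by rw [hz₁, hz₂]; linear_combination (1 / 4 : ℂ) * hs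
  -- Factoring the characteristic polynomial: v = x - z₂ y satisfies a first-order recurrence with
  -- root z₁ and input u, and x satisfies one with root z₂ whose input is v shifted by one.
  have hv : Summable fun k => ‖(x k - z₂ * y k : ℂ)‖ ^ 2 := by
    refine summable_sq_of_recurrence h₁ (u := fun k => (u k : ℂ)) (fun k => ?_) ?_
    · rw [hy, hx]
      push_cast
      linear_combination (y k : ℂ) * hprod + (-(x k : ℂ)) * hsum
    · simpa using hu
  have hxx : Summable fun k => ‖(x k : ℂ)‖ ^ 2 := by
    refine summable_sq_of_recurrence h₂ (u := fun k => (x (k + 1) - z₂ * y (k + 1) : ℂ))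
      (fun k => ?_) ((summable_nat_add_iff 1).2 hv)
    rw [hy]
    ring
  simpa using hxx

/-- Dissipation inequality of a scalar second-order system. -/
theorem SymbolCertificate.exists_storage {b c ρ τ σ c₁ c₂ c₃ : ℝ}
    (h : SymbolCertificate b c ρ τ σ c₁ c₂ c₃) :
    ∃ V : ℝ → ℝ → ℝ, V 0 0 = 0 ∧ ∀ {x y u : ℕ → ℝ}, (∀ k, y (k + 1) = x k) →
      (∀ k, x (k + 1) = -b * x k - c * y k + u k) → (Summable fun k => u k ^ 2) →
      (Summable fun k => x k ^ 2) →
      ρ * ∑' k, x k ^ 2 ≤ ∑' k, u k ^ 2 + V (x 0) (y 0) := by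
  obtain ⟨h1, h2, h3, hσ, hc, hb, hρ⟩ := h
  refine ⟨fun x y => (1 - c₁ - c₂ - c₃) * x ^ 2 + (2 * b + 4 * τ * c₁ + 2 * σ * c₂) * (x * y)
    + (c₁ + c₃ - c ^ 2) * y ^ 2, by ring, ?_⟩
  intro x y u hy hx hu hxs
  set V : ℝ → ℝ → ℝ := fun x y => (1 - c₁ - c₂ - c₃) * x ^ 2
    + (2 * b + 4 * τ * c₁ + 2 * σ * c₂) * (x * y) + (c₁ + c₃ - c ^ 2) * y ^ 2 with hV
  have hstep : ∀ k, ρ * x k ^ 2 + V (x (k + 1)) (y (k + 1)) - V (x k) (y k) ≤ u k ^ 2 := by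
    intro k
    have hu' : u k = x (k + 1) + b * x k + c * y k := by rw [hx]; ring
    -- On |z| = 1 the certificate's terms are |z - 2τ + z⁻¹|², |z - σ|² and |z - z⁻¹|². Reading z as
    -- the shift gives these squares; `V` collects what telescopes.
    have e : u k ^ 2 - (ρ * x k ^ 2 + V (x (k + 1)) (y (k + 1)) - V (x k) (y k))
        = c₁ * (x (k + 1) - 2 * τ * x k + y k) ^ 2 + c₂ * (x (k + 1) - σ * x k) ^ 2
          + c₃ * (x (k + 1) - y k) ^ 2 := by
      rw [hu', hy]
      simp only [hV]
      linear_combination (2 * (x (k + 1)) * y k) * hc + 2 * x k * y k * hb + x k ^ 2 * hρ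
        - c₂ * x k ^ 2 * hσ
    have := mul_nonneg h1 (sq_nonneg (x (k + 1) - 2 * τ * x k + y k))
    have := mul_nonneg h2 (sq_nonneg (x (k + 1) - σ * x k))
    have := mul_nonneg h3 (sq_nonneg (x (k + 1) - y k))
    linarith
  have hfin : ∀ n, ρ * ∑ k ∈ Finset.range n, x k ^ 2 + V (x n) (y n)
      ≤ ∑ k ∈ Finset.range n, u k ^ 2 + V (x 0) (y 0) := by
    intro n
    induction n with
    | zero => simp
    | succ n ih =>
      rw [Finset.sum_range_succ, Finset.sum_range_succ]
      have := hstep n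
      linarith
  have hx0 : Filter.Tendsto x Filter.atTop (nhds 0) := by
    have h := (hxs.tendsto_atTop_zero).sqrt
    simp only [Real.sqrt_sq_eq_abs, Real.sqrt_zero] at h
    exact (tendsto_zero_iff_abs_tendsto_zero x).2 h
  have hy0 : Filter.Tendsto y Filter.atTop (nhds 0) :=
    (Filter.tendsto_add_atTop_iff_nat 1).1 (by simpa only [hy] using hx0)
  have hV0 : Filter.Tendsto (fun n => V (x n) (y n)) Filter.atTop (nhds 0) := by
    have : Filter.Tendsto (fun n => V (x n) (y n)) Filter.atTop (nhds (V 0 0)) := by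
      simp only [hV]
      exact (((hx0.pow 2).const_mul _).add ((hx0.mul hy0).const_mul _)).add ((hy0.pow 2).const_mul _)
    simpa [hV] using this
  have hl := ((hxs.hasSum.tendsto_sum_nat.const_mul ρ).add hV0)
  have hr := hu.hasSum.tendsto_sum_nat.add_const (V (x 0) (y 0))
  have := le_of_tendsto_of_tendsto' hl hr hfin
  simpa using this

/-- Testing a quadratic inequality between a finitely supported sequence and its image under a
second-order difference operator on truncated exponentials. -/
theorem le_mul_norm_sq_of_finite_sequences {b c A G : ℝ} (hG : 0 ≤ G)
    (h : ∀ (N : ℕ) (X : ℕ → ℝ), X 0 = 0 → X 1 = 0 → (∀ k, N + 2 ≤ k → X k = 0) →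
      A * ∑ k ∈ Finset.range (N + 2), X (k + 1) ^ 2
        ≤ G * ∑ k ∈ Finset.range (N + 2), (X (k + 2) + b * X (k + 1) + c * X k) ^ 2)
    {z : ℂ} (hz : ‖z‖ = 1) : A ≤ G * ‖z ^ 2 + b * z + c‖ ^ 2 := by
  set m := ‖z ^ 2 + b * z + c‖ ^ 2 with hm
  set C := (1 + |b| + |c|) ^ 2 with hC
  have hfin : ∀ N : ℕ, A * N ≤ G * ((N + 2) * m + 4 * C) := by
    intro N
    -- The window has exactly N nonzero entries. Real and imaginary parts are tested separately and
    -- added.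
    let Z : ℕ → ℂ := fun k => if 2 ≤ k ∧ k < N + 2 then z ^ k else 0
    have hZ1 : ∀ k, ‖Z k‖ ≤ 1 := by
      intro k
      simp only [Z]
      split_ifs
      · rw [norm_pow, hz, one_pow]
      · simp
    have hre := h N (fun k => (Z k).re) (by simp [Z]) (by simp [Z])
      (fun k hk => by simp [Z, Nat.not_lt.2 hk])
    have him := h N (fun k => (Z k).im) (by simp [Z]) (by simp [Z])
      (fun k hk => by simp [Z, Nat.not_lt.2 hk])
    have hadd := add_le_add hre him
    rw [← mul_add, ← mul_add, ← Finset.sum_add_distrib, ← Finset.sum_add_distrib] at hadd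
    have e1 : ∑ k ∈ Finset.range (N + 2), ((Z (k + 1)).re ^ 2 + (Z (k + 1)).im ^ 2) = N := by
      rw [Finset.sum_range_succ, Finset.sum_range_succ']
      have : ∀ k ∈ Finset.range N, (Z (k + 1 + 1)).re ^ 2 + (Z (k + 1 + 1)).im ^ 2 = 1 := by
        intro k hk
        have hk' : 2 ≤ k + 1 + 1 ∧ k + 1 + 1 < N + 2 := by
          have := Finset.mem_range.1 hk
          omega
        have h1 : ‖z ^ (k + 1 + 1)‖ ^ 2 = 1 := by rw [norm_pow, hz, one_pow, one_pow]
        rw [Complex.sq_norm, Complex.normSq_apply] at h1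
        simp only [Z, if_pos hk']
        linarith
      rw [Finset.sum_congr rfl this]
      simp [Z]
    -- Inside the window the operator multiplies z^k by the symbol; only the indices 0, 1, N, N + 1
    -- see the truncation, so the error stays bounded as N grows.
    have e2 : ∀ k, ((Z (k + 2)).re + b * (Z (k + 1)).re + c * (Z k).re) ^ 2
        + ((Z (k + 2)).im + b * (Z (k + 1)).im + c * (Z k).im) ^ 2
        ≤ m + if k ∈ ({0, 1, N, N + 1} : Finset ℕ) then C else 0 := by
      intro k
      have e : ((Z (k + 2)).re + b * (Z (k + 1)).re + c * (Z k).re) ^ 2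
        + ((Z (k + 2)).im + b * (Z (k + 1)).im + c * (Z k).im) ^ 2
        = ‖Z (k + 2) + b * Z (k + 1) + c * Z k‖ ^ 2 := by
        rw [Complex.sq_norm, Complex.normSq_apply]
        simp
        ring
      rw [e]
      split_ifs with hk
      · have h1 : ‖Z (k + 2) + b * Z (k + 1) + c * Z k‖ ≤ 1 + |b| + |c| := by
          refine (norm_add₃_le).trans ?_
          rw [norm_mul, norm_mul, Complex.norm_real, Complex.norm_real, Real.norm_eq_abs,
            Real.norm_eq_abs]
          have := hZ1 (k + 2)
          have := mul_le_of_le_one_right (abs_nonneg b) (hZ1 (k + 1))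
          have := mul_le_of_le_one_right (abs_nonneg c) (hZ1 k)
          linarith
        have h2 := pow_le_pow_left₀ (norm_nonneg _) h1 2
        have : 0 ≤ m := by positivity
        linarith
      · simp only [Finset.mem_insert, Finset.mem_singleton, not_or] at hk
        rcases lt_or_ge k N with hkN | hkN
        · have e3 : Z (k + 2) + b * Z (k + 1) + c * Z k = z ^ k * (z ^ 2 + b * z + c) := by
            simp only [Z]
            rw [if_pos (by omega), if_pos (by omega), if_pos (by omega)]
            ring
          rw [e3, norm_mul, norm_pow, hz, one_pow, one_mul, add_zero]
        · have e3 : Z (k + 2) + b * Z (k + 1) + c * Z k = 0 := by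
            simp only [Z]
            rw [if_neg (by omega), if_neg (by omega), if_neg (by omega)]
            ring
          rw [e3, norm_zero, add_zero, zero_pow two_ne_zero]
          positivity
    have e4 : ∑ k ∈ Finset.range (N + 2), (m + if k ∈ ({0, 1, N, N + 1} : Finset ℕ) then C else 0)
        ≤ (N + 2) * m + 4 * C := by
      rw [Finset.sum_add_distrib, Finset.sum_const, Finset.card_range, nsmul_eq_mul,
        ← Finset.sum_filter, Finset.sum_const, nsmul_eq_mul]
      push_cast
      have hcard : (((Finset.range (N + 2)).filter
          (· ∈ ({0, 1, N, N + 1} : Finset ℕ))).card : ℝ) ≤ 4 := by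
        have h1 : ((Finset.range (N + 2)).filter (· ∈ ({0, 1, N, N + 1} : Finset ℕ))).card
            ≤ ({0, 1, N, N + 1} : Finset ℕ).card :=
          Finset.card_le_card fun k hk => (Finset.mem_filter.1 hk).2
        exact_mod_cast h1.trans Finset.card_le_four
      gcongr
    rw [e1] at hadd
    refine hadd.trans (mul_le_mul_of_nonneg_left ?_ hG)
    exact (Finset.sum_le_sum fun k _ => e2 k).trans e4
  by_contra! hlt
  obtain ⟨N, hN⟩ := exists_nat_gt (G * (2 * m + 4 * C) / (A - G * m))
  rw [div_lt_iff₀ (by linarith)] at hN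
  have := hfin N
  nlinarith

/-! ### Diagonalization and the transfer matrix. -/

theorem orthogonal_transpose_mul {d : ℕ} {U : Matrix (Fin d) (Fin d) ℝ}
    (hU : U ∈ Matrix.orthogonalGroup (Fin d) ℝ) : Uᵀ * U = 1 :=
  (Matrix.mem_orthogonalGroup_iff' (Fin d) ℝ).1 hU

theorem orthogonal_mul_transpose {d : ℕ} {U : Matrix (Fin d) (Fin d) ℝ}
    (hU : U ∈ Matrix.orthogonalGroup (Fin d) ℝ) : U * Uᵀ = 1 :=
  (Matrix.mem_orthogonalGroup_iff (Fin d) ℝ).1 hU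

theorem spectrum_eq_range {d : ℕ} {Q U : Matrix (Fin d) (Fin d) ℝ} {lam : Fin d → ℝ}
    (hU : U ∈ Matrix.orthogonalGroup (Fin d) ℝ) (hdec : Q = U * Matrix.diagonal lam * Uᵀ) :
    spectrum ℝ Q = Set.range lam := by
  let u : (Matrix (Fin d) (Fin d) ℝ)ˣ :=
    ⟨U, Uᵀ, orthogonal_mul_transpose hU, orthogonal_transpose_mul hU⟩
  have h : Q = u * Matrix.diagonal lam * (u⁻¹ : (Matrix (Fin d) (Fin d) ℝ)ˣ) := hdec
  rw [h, spectrum.units_conjugate, spectrum_diagonal]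

/-- The matrix `z I - A_Q` acts on `[z U D; U D]` through the characteristic polynomials
`z² + b_λ z + c_λ`. -/
theorem sub_gmmA_mul {d : ℕ} {m : Type*} [Fintype m] {Q U : Matrix (Fin d) (Fin d) ℝ}
    {lam : Fin d → ℝ}
    (hU : U ∈ Matrix.orthogonalGroup (Fin d) ℝ) (hdec : Q = U * Matrix.diagonal lam * Uᵀ)
    (α β ν : ℝ) (z : ℂ) (D : Matrix (Fin d) m ℂ) :
    (z • (1 : Matrix (Fin d ⊕ Fin d) (Fin d ⊕ Fin d) ℂ) - (gmmA Q α β ν).map Complex.ofReal) *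
      Matrix.fromRows (z • (U.map Complex.ofReal * D)) (U.map Complex.ofReal * D) =
    Matrix.fromRows (U.map Complex.ofReal * (Matrix.diagonal (fun i =>
      z ^ 2 + (bCoef α β ν (lam i) : ℂ) * z + (cCoef α β ν (lam i) : ℂ)) * D)) 0 := by
  have hQU : Q.map Complex.ofReal * U.map Complex.ofReal
      = U.map Complex.ofReal * Matrix.diagonal (fun i => (lam i : ℂ)) := by
    have h : Q * U = U * Matrix.diagonal lam := by
      rw [hdec, mul_assoc, orthogonal_transpose_mul hU, mul_one]
    have h2 := congrArg (fun M => M.map Complex.ofRealHom) h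
    simp only [Matrix.map_mul] at h2
    rw [Matrix.diagonal_map (map_zero _)] at h2
    exact h2
  have hQD : Q.map Complex.ofReal * (U.map Complex.ofReal * D)
      = U.map Complex.ofReal * (Matrix.diagonal (fun i => (lam i : ℂ)) * D) := by
    rw [← Matrix.mul_assoc, hQU, Matrix.mul_assoc]
  have hdiag : (Matrix.diagonal (fun i =>
      z ^ 2 + (bCoef α β ν (lam i) : ℂ) * z + (cCoef α β ν (lam i) : ℂ)) : Matrix _ _ ℂ)
      = (z ^ 2 - (1 + β) * z + β) • 1
        + (α * (1 + ν) * z - α * ν) • Matrix.diagonal (fun i => (lam i : ℂ)) := by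
    ext i j
    rcases eq_or_ne i j with rfl | hij
    · simp [bCoef, cCoef]; ring
    · simp [hij]
  have hA : z • (1 : Matrix (Fin d ⊕ Fin d) (Fin d ⊕ Fin d) ℂ) - (gmmA Q α β ν).map Complex.ofReal
      = Matrix.fromBlocks (z • 1 - ((1 + β : ℂ) • 1 - (α * (1 + ν) : ℂ) • Q.map Complex.ofReal))
        ((β : ℂ) • 1 - (α * ν : ℂ) • Q.map Complex.ofReal) (-1) (z • 1) := by
    ext (i | i) (j | j) <;>
    · rcases eq_or_ne i j with rfl | hij
      · simp [gmmA]; try ring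
      · simp [gmmA, hij]
  rw [hA, Matrix.fromBlocks_mul_fromRows, hdiag]
  congr 1
  · simp only [Matrix.sub_mul, Matrix.smul_mul, Matrix.mul_smul, Matrix.one_mul, hQD,
      Matrix.add_mul, Matrix.mul_add]
    module
  · simp

theorem isUnit_sub_gmmA {d : ℕ} {Q : Matrix (Fin d) (Fin d) ℝ}
    {α β ν : ℝ} (hρ : spectralRadius ℂ ((gmmA Q α β ν).map Complex.ofReal) < 1)
    {z : ℂ} (hz : 1 ≤ ‖z‖) :
    IsUnit (z • (1 : Matrix (Fin d ⊕ Fin d) (Fin d ⊕ Fin d) ℂ)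
      - (gmmA Q α β ν).map Complex.ofReal) := by
  have h := spectrum.mem_resolventSet_of_spectralRadius_lt (k := z)
    (hρ.trans_le (by exact_mod_cast hz))
  rwa [spectrum.mem_resolventSet_iff, Algebra.algebraMap_eq_smul_one] at h

theorem map_ofReal_orthogonal {d : ℕ} {U : Matrix (Fin d) (Fin d) ℝ}
    (hU : U ∈ Matrix.orthogonalGroup (Fin d) ℝ) :
    Uᵀ.map Complex.ofReal * U.map Complex.ofReal = 1 := by
  have h := congrArg (fun M => M.map Complex.ofRealHom) (orthogonal_transpose_mul hU)
  simp only [Matrix.map_mul] at h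
  rw [Matrix.map_one _ (map_zero _) (map_one _)] at h
  exact h

/-- The characteristic roots of every eigenvalue lie in the open unit disk. -/
theorem norm_lt_one_of_root {d : ℕ} {Q U : Matrix (Fin d) (Fin d) ℝ} {lam : Fin d → ℝ}
    (hU : U ∈ Matrix.orthogonalGroup (Fin d) ℝ) (hdec : Q = U * Matrix.diagonal lam * Uᵀ)
    {α β ν : ℝ} (hρ : spectralRadius ℂ ((gmmA Q α β ν).map Complex.ofReal) < 1)
    (i : Fin d) {z : ℂ}
    (hz : z ^ 2 + (bCoef α β ν (lam i) : ℂ) * z + (cCoef α β ν (lam i) : ℂ) = 0) : ‖z‖ < 1 := by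
  by_contra! h1
  have hu := isUnit_sub_gmmA hρ h1
  -- With D the matrix unit at i, a root z puts the columns of [z U D; U D] in the kernel of z I -
  -- A_Q, so invertibility would force D = 0.
  have hmul := sub_gmmA_mul hU hdec α β ν z (Matrix.diagonal (Pi.single i (1 : ℂ)))
  have hzero : (Matrix.diagonal (fun j => z ^ 2 + (bCoef α β ν (lam j) : ℂ) * z
      + (cCoef α β ν (lam j) : ℂ)) * Matrix.diagonal (Pi.single i (1 : ℂ)) : Matrix _ _ ℂ) = 0 := by
    rw [Matrix.diagonal_mul_diagonal, ← Matrix.diagonal_zero]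
    congr 1
    ext j
    rcases eq_or_ne j i with rfl | hj
    · simp [hz]
    · simp [hj]
  rw [hzero, Matrix.mul_zero, Matrix.fromRows_zero] at hmul
  rw [Matrix.isUnit_iff_isUnit_det] at hu
  have hN := congrArg (fun M => (z • (1 : Matrix (Fin d ⊕ Fin d) (Fin d ⊕ Fin d) ℂ)
      - (gmmA Q α β ν).map Complex.ofReal)⁻¹ * M) hmul
  simp only [Matrix.nonsing_inv_mul_cancel_left _ _ hu, Matrix.mul_zero] at hN
  rw [← Matrix.fromRows_zero, Matrix.fromRows_ext_iff] at hN
  have hD := congrArg (fun M => Uᵀ.map Complex.ofReal * M) hN.2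
  simp only [← Matrix.mul_assoc, map_ofReal_orthogonal hU, Matrix.one_mul, Matrix.mul_zero] at hD
  have := congrFun (congrFun hD i) i
  simp at this



/-- The transfer matrix of GMM in the eigenbasis. -/
theorem transferMatrix_gmm {d : ℕ} {Q U : Matrix (Fin d) (Fin d) ℝ} {lam : Fin d → ℝ}
    (hU : U ∈ Matrix.orthogonalGroup (Fin d) ℝ) (hdec : Q = U * Matrix.diagonal lam * Uᵀ)
    {α β ν : ℝ} (hρ : spectralRadius ℂ ((gmmA Q α β ν).map Complex.ofReal) < 1)
    {z : ℂ} (hz : ‖z‖ = 1) :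
    transferMatrix (gmmA Q α β ν) (gmmB d α) (gmmT U lam) z =
      Matrix.diagonal (fun i => -((α / √2 * √(lam i) : ℝ) : ℂ) * z /
        (z ^ 2 + (bCoef α β ν (lam i) : ℂ) * z + (cCoef α β ν (lam i) : ℂ))) *
      Uᵀ.map Complex.ofReal := by
  have hu := isUnit_sub_gmmA hρ hz.ge
  rw [Matrix.isUnit_iff_isUnit_det] at hu
  have hp : ∀ i, z ^ 2 + (bCoef α β ν (lam i) : ℂ) * z + (cCoef α β ν (lam i) : ℂ) ≠ 0 :=
    fun i h => (norm_lt_one_of_root hU hdec hρ i h).ne hz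
  -- Chosen so that z I - A_Q maps [z U D; U D] to B, which computes the resolvent applied to B
  -- without inverting a block matrix.
  set D : Matrix (Fin d) (Fin d) ℂ := Matrix.diagonal (fun i => -(α : ℂ) /
    (z ^ 2 + (bCoef α β ν (lam i) : ℂ) * z + (cCoef α β ν (lam i) : ℂ))) * Uᵀ.map Complex.ofReal
    with hD
  have hUU : U.map Complex.ofReal * Uᵀ.map Complex.ofReal = 1 := by
    rw [mul_eq_one_comm]
    exact map_ofReal_orthogonal hU
  have hB : (gmmB d α).map Complex.ofReal = Matrix.fromRows (U.map Complex.ofReal *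
      (Matrix.diagonal (fun i => z ^ 2 + (bCoef α β ν (lam i) : ℂ) * z
        + (cCoef α β ν (lam i) : ℂ)) * D)) 0 := by
    have h1 : (Matrix.diagonal (fun i => z ^ 2 + (bCoef α β ν (lam i) : ℂ) * z
        + (cCoef α β ν (lam i) : ℂ)) * D) = -(α : ℂ) • Uᵀ.map Complex.ofReal := by
      rw [hD, ← Matrix.mul_assoc, Matrix.diagonal_mul_diagonal]
      ext i j
      simp only [Matrix.diagonal_mul, Matrix.smul_apply, smul_eq_mul]
      rw [mul_div_cancel₀ _ (hp i)]
    rw [h1, Matrix.mul_smul, hUU]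
    ext (i | i) j
    · rcases eq_or_ne i j with rfl | hij
      · simp [gmmB]
      · simp [gmmB, hij]
    · simp [gmmB]
  have hT : (gmmT U lam).map Complex.ofReal = Matrix.fromCols
      (Matrix.diagonal (fun i => ((√(lam i) / √2 : ℝ) : ℂ)) * Uᵀ.map Complex.ofReal) 0 := by
    ext i (j | j)
    · simp [gmmT, Matrix.diagonal_mul]
      ring
    · simp [gmmT]
  rw [transferMatrix, Matrix.mul_assoc, hB, ← sub_gmmA_mul hU hdec,
    Matrix.nonsing_inv_mul_cancel_left _ _ hu, hT, Matrix.fromCols_mul_fromRows, Matrix.zero_mul,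
    add_zero, Matrix.mul_smul, Matrix.mul_assoc, ← Matrix.mul_assoc (Uᵀ.map Complex.ofReal),
    map_ofReal_orthogonal hU, Matrix.one_mul, hD, ← Matrix.mul_assoc,
    Matrix.diagonal_mul_diagonal]
  ext i j
  simp only [Matrix.diagonal_mul, Matrix.smul_apply, smul_eq_mul]
  push_cast
  ring

open Matrix.Norms.L2Operator in
theorem spectralNorm₂_diagonal_mul_orthogonal {d : ℕ} {U : Matrix (Fin d) (Fin d) ℝ}
    (hU : U ∈ Matrix.orthogonalGroup (Fin d) ℝ) (g : Fin d → ℂ) :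
    spectralNorm₂ (Matrix.diagonal g * Uᵀ.map Complex.ofReal) = ‖g‖ := by
  have hmem : Uᵀ.map Complex.ofReal ∈ unitary (Matrix (Fin d) (Fin d) ℂ) := by
    have hstar : star (Uᵀ.map Complex.ofReal) = U.map Complex.ofReal := by
      ext i j
      simp [Matrix.star_apply]
    rw [Unitary.mem_iff, hstar]
    exact ⟨by rw [mul_eq_one_comm]; exact map_ofReal_orthogonal hU,
      map_ofReal_orthogonal hU⟩
  rw [spectralNorm₂, ← Matrix.cstar_norm_def, CStarRing.norm_mul_mem_unitary _ hmem,
    Matrix.l2_opNorm_diagonal]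

/-- The spectral norm of the transfer matrix on the unit circle. -/
theorem spectralNorm₂_transferMatrix_gmm {d : ℕ} {Q U : Matrix (Fin d) (Fin d) ℝ}
    {lam : Fin d → ℝ} (hU : U ∈ Matrix.orthogonalGroup (Fin d) ℝ)
    (hdec : Q = U * Matrix.diagonal lam * Uᵀ) {α β ν : ℝ}
    (hρ : spectralRadius ℂ ((gmmA Q α β ν).map Complex.ofReal) < 1) {z : ℂ} (hz : ‖z‖ = 1) :
    spectralNorm₂ (transferMatrix (gmmA Q α β ν) (gmmB d α) (gmmT U lam) z) =
      ‖fun i => α / √2 * (√(lam i) /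
        √(symbolSq (bCoef α β ν (lam i)) (cCoef α β ν (lam i)) z.re))‖ := by
  rw [transferMatrix_gmm hU hdec hρ hz, spectralNorm₂_diagonal_mul_orthogonal hU]
  simp only [Pi.norm_def]
  congr 2
  ext i
  rw [coe_nnnorm, coe_nnnorm, ← Complex.norm_sq_quadratic hz, Real.sqrt_sq (norm_nonneg _),
    norm_div, norm_mul, norm_neg, hz, mul_one, Complex.norm_real, norm_mul, norm_mul, norm_div,
    norm_div, norm_norm]
  ring

/-! ### The iteration in eigen-coordinates and bounds on its gain. -/

theorem hasGradientAt_quadObjective {d : ℕ} {Q : Matrix (Fin d) (Fin d) ℝ} (hQ : Qᵀ = Q)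
    (p : EuclideanSpace ℝ (Fin d)) (r : ℝ) (x : EuclideanSpace ℝ (Fin d)) :
    HasGradientAt (quadObjective Q p r) (WithLp.toLp 2 (Q *ᵥ x.ofLp) + p) x := by
  have hf : quadObjective Q p r = fun x => (1 / 2) * inner ℝ x (Matrix.toEuclideanCLM (𝕜 := ℝ) Q x)
      + inner ℝ p x + r := by
    ext x
    simp [quadObjective, EuclideanSpace.inner_eq_star_dotProduct, dotProduct_comm]
  rw [hasGradientAt_iff_hasFDerivAt, hf]
  have h1 : HasFDerivAt (fun x => inner ℝ x (Matrix.toEuclideanCLM (𝕜 := ℝ) Q x)) _ x :=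
    (hasFDerivAt_id x).inner ℝ (Matrix.toEuclideanCLM (𝕜 := ℝ) Q).hasFDerivAt
  have h2 : HasFDerivAt (fun x => inner ℝ p x) (innerSL ℝ p) x := (innerSL ℝ p).hasFDerivAt
  refine (((h1.const_mul (1 / 2)).add h2).add_const r).congr_fderiv ?_
  ext h
  have hsymm : x.ofLp ⬝ᵥ (Q *ᵥ h.ofLp) = h.ofLp ⬝ᵥ (Q *ᵥ x.ofLp) := by
    rw [Matrix.dotProduct_mulVec, ← Matrix.mulVec_transpose, hQ, dotProduct_comm]
  simp [EuclideanSpace.inner_eq_star_dotProduct, dotProduct_comm]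
  rw [hsymm]
  ring

theorem quadObjective_stationary {d : ℕ} {Q : Matrix (Fin d) (Fin d) ℝ} (hQ : Qᵀ = Q)
    {p : EuclideanSpace ℝ (Fin d)} {r : ℝ} {xs : EuclideanSpace ℝ (Fin d)}
    (hxs : IsMinOn (quadObjective Q p r) Set.univ xs) : Q *ᵥ xs.ofLp + p.ofLp = 0 := by
  have h := (hasGradientAt_quadObjective hQ p r xs)
  rw [hasGradientAt_iff_hasFDerivAt] at h
  have h0 := (hxs.isLocalMin Filter.univ_mem).hasFDerivAt_eq_zero h
  have h1 : WithLp.toLp 2 (Q *ᵥ xs.ofLp) + p = 0 :=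
    (map_eq_zero_iff _ (InnerProductSpace.toDual ℝ (EuclideanSpace ℝ (Fin d))).injective).1
      h0
  exact congrArg WithLp.ofLp h1

theorem transpose_mulVec_eigen {d : ℕ} {Q U : Matrix (Fin d) (Fin d) ℝ} {lam : Fin d → ℝ}
    (hU : U ∈ Matrix.orthogonalGroup (Fin d) ℝ) (hdec : Q = U * Matrix.diagonal lam * Uᵀ)
    (v : Fin d → ℝ) (i : Fin d) : (Uᵀ *ᵥ (Q *ᵥ v)) i = lam i * (Uᵀ *ᵥ v) i := by
  rw [Matrix.mulVec_mulVec, hdec, ← mul_assoc, ← mul_assoc, orthogonal_transpose_mul hU, one_mul,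
    ← Matrix.mulVec_mulVec, Matrix.mulVec_diagonal]

theorem norm_sq_eq_sum_transpose_mulVec {d : ℕ} {U : Matrix (Fin d) (Fin d) ℝ}
    (hU : U ∈ Matrix.orthogonalGroup (Fin d) ℝ) (v : EuclideanSpace ℝ (Fin d)) :
    ‖v‖ ^ 2 = ∑ i, (Uᵀ *ᵥ v.ofLp) i ^ 2 := by
  have h : (Uᵀ *ᵥ v.ofLp) ⬝ᵥ (Uᵀ *ᵥ v.ofLp) = v.ofLp ⬝ᵥ v.ofLp := by
    rw [Matrix.dotProduct_mulVec, Matrix.vecMul_transpose, Matrix.mulVec_mulVec,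
      orthogonal_mul_transpose hU, Matrix.one_mulVec]
  rw [EuclideanSpace.real_norm_sq_eq]
  simp only [dotProduct, ← pow_two] at h
  exact h.symm

theorem quadObjective_sub {d : ℕ} {Q U : Matrix (Fin d) (Fin d) ℝ} {lam : Fin d → ℝ}
    (hU : U ∈ Matrix.orthogonalGroup (Fin d) ℝ) (hdec : Q = U * Matrix.diagonal lam * Uᵀ)
    (hQ : Qᵀ = Q) {p : EuclideanSpace ℝ (Fin d)} {r : ℝ} {xs : EuclideanSpace ℝ (Fin d)}
    (hxs : Q *ᵥ xs.ofLp + p.ofLp = 0) (x : EuclideanSpace ℝ (Fin d)) :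
    quadObjective Q p r x - quadObjective Q p r xs
      = ∑ i, lam i / 2 * (Uᵀ *ᵥ (x - xs).ofLp) i ^ 2 := by
  have hp : p.ofLp = -(Q *ᵥ xs.ofLp) := by rw [eq_neg_iff_add_eq_zero, add_comm]; exact hxs
  obtain ⟨v, rfl⟩ : ∃ v, x = xs + v := ⟨x - xs, by abel⟩
  have hsymm : ∀ u w : Fin d → ℝ, u ⬝ᵥ (Q *ᵥ w) = w ⬝ᵥ (Q *ᵥ u) := by
    intro u w
    rw [Matrix.dotProduct_mulVec, ← Matrix.mulVec_transpose, hQ, dotProduct_comm]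
  have h1 : v.ofLp ⬝ᵥ (Q *ᵥ v.ofLp) = ∑ i, lam i * (Uᵀ *ᵥ v.ofLp) i ^ 2 := by
    have : (Uᵀ *ᵥ v.ofLp) ⬝ᵥ (Uᵀ *ᵥ (Q *ᵥ v.ofLp)) = v.ofLp ⬝ᵥ (Q *ᵥ v.ofLp) := by
      rw [dotProduct_comm, Matrix.dotProduct_mulVec, Matrix.vecMul_transpose,
        Matrix.mulVec_mulVec, orthogonal_mul_transpose hU, Matrix.one_mulVec, dotProduct_comm]
    rw [← this, dotProduct]
    refine Finset.sum_congr rfl fun i _ => ?_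
    rw [transpose_mulVec_eigen hU hdec]
    ring
  have h2 : ∑ i, lam i / 2 * (Uᵀ *ᵥ (xs + v - xs).ofLp) i ^ 2
      = 1 / 2 * (v.ofLp ⬝ᵥ (Q *ᵥ v.ofLp)) := by
    rw [h1, Finset.mul_sum, add_sub_cancel_left]
    exact Finset.sum_congr rfl fun i _ => by ring
  rw [h2]
  simp only [quadObjective, WithLp.ofLp_add, Matrix.mulVec_add, add_dotProduct, dotProduct_add, hp,
    neg_dotProduct]
  rw [hsymm xs.ofLp v.ofLp, dotProduct_comm (Q *ᵥ xs.ofLp) v.ofLp]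
  ring

/-- The recursion of GMM around the minimizer. -/
theorem gmmState_succ_fst {d : ℕ} {Q : Matrix (Fin d) (Fin d) ℝ} (hQ : Qᵀ = Q)
    {p : EuclideanSpace ℝ (Fin d)} {r : ℝ} {xs : EuclideanSpace ℝ (Fin d)}
    (hxs : Q *ᵥ xs.ofLp + p.ofLp = 0) (α β ν : ℝ) (w : ℕ → EuclideanSpace ℝ (Fin d))
    (ξ₀ : EuclideanSpace ℝ (Fin d) × EuclideanSpace ℝ (Fin d)) (k : ℕ)
    {v v' : EuclideanSpace ℝ (Fin d)}
    (hv : (gmmState (quadObjective Q p r) α β ν w ξ₀ k).1 = xs + v)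
    (hv' : (gmmState (quadObjective Q p r) α β ν w ξ₀ k).2 = xs + v') :
    ((gmmState (quadObjective Q p r) α β ν w ξ₀ (k + 1)).1 - xs).ofLp =
      (1 + β) • v.ofLp - β • v'.ofLp - (α * (1 + ν)) • (Q *ᵥ v.ofLp)
        + (α * ν) • (Q *ᵥ v'.ofLp) - α • (w k).ofLp := by
  have hp : p.ofLp = -(Q *ᵥ xs.ofLp) := by rw [eq_neg_iff_add_eq_zero, add_comm]; exact hxs
  simp only [gmmState, hv, hv', (hasGradientAt_quadObjective hQ p r _).gradient]
  simp only [WithLp.ofLp_add, WithLp.ofLp_sub, WithLp.ofLp_smul, hp, Matrix.mulVec_add,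
    Matrix.mulVec_smul, Matrix.mulVec_sub]
  module

/-- An upper bound on the gain from bounds on all modes. -/
theorem hasL2GainLE_of_modes {d : ℕ} {Q U : Matrix (Fin d) (Fin d) ℝ} {lam : Fin d → ℝ}
    (hU : U ∈ Matrix.orthogonalGroup (Fin d) ℝ) (hdec : Q = U * Matrix.diagonal lam * Uᵀ)
    (hQ : Qᵀ = Q) {p : EuclideanSpace ℝ (Fin d)} {r : ℝ} {xs : EuclideanSpace ℝ (Fin d)}
    (hxs : Q *ᵥ xs.ofLp + p.ofLp = 0) {α β ν : ℝ} (hlam : ∀ i, 0 < lam i)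
    (hroots : ∀ (i : Fin d) (z : ℂ),
      z ^ 2 + (bCoef α β ν (lam i) : ℂ) * z + (cCoef α β ν (lam i) : ℂ) = 0 → ‖z‖ < 1)
    {ρ : Fin d → ℝ} (hρ : ∀ i, 0 < ρ i)
    (hcert : ∀ i, ∃ τ σ c₁ c₂ c₃, SymbolCertificate (bCoef α β ν (lam i)) (cCoef α β ν (lam i))
      (ρ i) τ σ c₁ c₂ c₃)
    (γ : ℝ≥0) (hγ : ∀ i, lam i / 2 * α ^ 2 ≤ (γ : ℝ) ^ 2 * ρ i) :
    HasL2GainLE (quadObjective Q p r) xs α β ν γ := by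
  have hst : ∀ i, ∃ V : ℝ → ℝ → ℝ, V 0 0 = 0 ∧ ∀ {x y u : ℕ → ℝ}, (∀ k, y (k + 1) = x k) →
      (∀ k, x (k + 1) = -bCoef α β ν (lam i) * x k - cCoef α β ν (lam i) * y k + u k) →
      (Summable fun k => u k ^ 2) → (Summable fun k => x k ^ 2) →
      ρ i * ∑' k, x k ^ 2 ≤ ∑' k, u k ^ 2 + V (x 0) (y 0) := by
    intro i
    obtain ⟨τ, σ, c₁, c₂, c₃, h⟩ := hcert i
    exact h.exists_storage
  choose V hV0 hV using hst
  -- Each mode's storage function is weighted by λ_i/(2ρ_i). It may be negative, hence the absolute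
  -- value; it vanishes at the minimizer.
  refine ⟨fun ξ => ∑ i, Real.toNNReal (lam i / 2 / ρ i) *
    Real.toNNReal |V i ((Uᵀ *ᵥ (ξ.1 - xs).ofLp) i) ((Uᵀ *ᵥ (ξ.2 - xs).ofLp) i)|, ?_, ?_⟩
  · simp [hV0]
  intro ξ₀ w hw
  set ξ := gmmState (quadObjective Q p r) α β ν w ξ₀ with hξ
  set x : Fin d → ℕ → ℝ := fun i k => (Uᵀ *ᵥ ((ξ k).1 - xs).ofLp) i with hx
  set y : Fin d → ℕ → ℝ := fun i k => (Uᵀ *ᵥ ((ξ k).2 - xs).ofLp) i with hy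
  set ω : Fin d → ℕ → ℝ := fun i k => (Uᵀ *ᵥ (w k).ofLp) i with hω
  have hyx : ∀ i k, y i (k + 1) = x i k := fun i k => rfl
  have hrec : ∀ i k, x i (k + 1)
      = -bCoef α β ν (lam i) * x i k - cCoef α β ν (lam i) * y i k + -α * ω i k := by
    intro i k
    simp only [hx, hy, hω]
    rw [hξ, gmmState_succ_fst hQ hxs α β ν w ξ₀ k (v := (ξ k).1 - xs) (v' := (ξ k).2 - xs)
      (by rw [hξ]; abel) (by rw [hξ]; abel)]
    simp only [Matrix.mulVec_add, Matrix.mulVec_sub, Matrix.mulVec_smul, Pi.add_apply,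
      Pi.sub_apply, Pi.smul_apply, smul_eq_mul, transpose_mulVec_eigen hU hdec, bCoef, cCoef]
    ring
  have hwsum : ∀ k, ‖w k‖ ^ 2 = ∑ i, ω i k ^ 2 := fun k => norm_sq_eq_sum_transpose_mulVec hU _
  have hωs : ∀ i, Summable fun k => ω i k ^ 2 := fun i =>
    Summable.of_nonneg_of_le (fun _ => sq_nonneg _) (fun k => by
      rw [hwsum]
      exact Finset.single_le_sum (f := fun i => ω i k ^ 2) (fun _ _ => sq_nonneg _)
        (Finset.mem_univ i)) hw
  have hus : ∀ i, Summable fun k => (-α * ω i k) ^ 2 := fun i => by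
    simp only [mul_pow]
    exact (hωs i).mul_left _
  have hxsum : ∀ i, Summable fun k => x i k ^ 2 := fun i =>
    summable_sq_of_recurrence_two (hroots i) (hyx i) (hrec i) (hus i)
  have hobj : ∀ k, quadObjective Q p r (ξ k).1 - quadObjective Q p r xs
      = ∑ i, lam i / 2 * x i k ^ 2 := fun k => quadObjective_sub hU hdec hQ hxs _
  simp only [hobj, hwsum]
  have hterm : ∀ i ∈ Finset.univ, Summable fun k => lam i / 2 * x i k ^ 2 :=
    fun i _ => (hxsum i).mul_left _
  refine ⟨summable_sum hterm, ?_⟩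
  rw [Summable.tsum_finsetSum hterm, Summable.tsum_finsetSum fun i _ => hωs i, Finset.mul_sum,
    NNReal.coe_sum, ← Finset.sum_add_distrib]
  refine Finset.sum_le_sum fun i _ => ?_
  have hmain := hV i (hyx i) (hrec i) (hus i) (hxsum i)
  simp only [mul_pow, neg_sq] at hmain
  rw [tsum_mul_left] at hmain ⊢
  have h2 : 0 < lam i / 2 / ρ i := div_pos (half_pos (hlam i)) (hρ i)
  rw [NNReal.coe_mul, Real.coe_toNNReal _ h2.le, Real.coe_toNNReal _ (abs_nonneg _)]
  have h3 : lam i / 2 * ∑' k, x i k ^ 2 = lam i / 2 / ρ i * (ρ i * ∑' k, x i k ^ 2) := by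
    have := (hρ i).ne'
    field_simp
  have h4 : lam i / 2 / ρ i * α ^ 2 ≤ (γ : ℝ) ^ 2 := by
    have := hγ i
    rw [div_mul_eq_mul_div, div_le_iff₀ (hρ i)]
    exact this
  have h5 : 0 ≤ ∑' k, ω i k ^ 2 := tsum_nonneg fun _ => sq_nonneg _
  have h6 := mul_le_mul_of_nonneg_left (hmain.trans (add_le_add_right (le_abs_self _) _)) h2.le
  have h7 := mul_le_mul_of_nonneg_right h4 h5
  rw [h3]
  simp only [hx, hy] at h6
  refine h6.trans ?_
  rw [mul_add, ← mul_assoc]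
  exact add_le_add_left h7 _

/-- A lower bound on the gain from a single mode. -/
theorem HasL2GainLE.mode_le {d : ℕ} {Q U : Matrix (Fin d) (Fin d) ℝ} {lam : Fin d → ℝ}
    (hU : U ∈ Matrix.orthogonalGroup (Fin d) ℝ) (hdec : Q = U * Matrix.diagonal lam * Uᵀ)
    (hQ : Qᵀ = Q) {p : EuclideanSpace ℝ (Fin d)} {r : ℝ} {xs : EuclideanSpace ℝ (Fin d)}
    (hxs : Q *ᵥ xs.ofLp + p.ofLp = 0) {α β ν : ℝ} (hα : 0 < α) {γ : ℝ≥0}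
    (h : HasL2GainLE (quadObjective Q p r) xs α β ν γ) (i : Fin d) {t : ℝ}
    (ht : t ∈ Set.Icc (-1 : ℝ) 1) :
    lam i / 2 * α ^ 2 ≤
      (γ : ℝ) ^ 2 * symbolSq (bCoef α β ν (lam i)) (cCoef α β ν (lam i)) t := by
  obtain ⟨z, hz, rfl⟩ := exists_norm_eq_one_re ht
  rw [← Complex.norm_sq_quadratic hz]
  set b := bCoef α β ν (lam i) with hb
  set c := cCoef α β ν (lam i) with hc
  obtain ⟨H, hH, hall⟩ := h
  set e : EuclideanSpace ℝ (Fin d) := WithLp.toLp 2 (U *ᵥ Pi.single i 1) with he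
  have hUe : Uᵀ *ᵥ e.ofLp = Pi.single i 1 := by
    rw [he, Matrix.mulVec_mulVec, orthogonal_transpose_mul hU, Matrix.one_mulVec]
  have hQe : Q *ᵥ e.ofLp = lam i • e.ofLp := by
    rw [he, hdec, Matrix.mulVec_mulVec, mul_assoc, mul_assoc, orthogonal_transpose_mul hU, mul_one,
      ← Matrix.mulVec_mulVec, Matrix.diagonal_mulVec_single, ← Matrix.mulVec_smul, ← Pi.single_smul]
    simp
  have hne : ‖e‖ ^ 2 = 1 := by
    rw [norm_sq_eq_sum_transpose_mulVec hU, hUe]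
    simp [Pi.single_apply]
  refine le_mul_norm_sq_of_finite_sequences (sq_nonneg _) (fun N X hX0 hX1 hXN => ?_) hz
  set R : ℕ → ℝ := fun k => X (k + 2) + b * X (k + 1) + c * X k with hR
  -- This error drives the state along the prescribed sequence X times the eigenvector, shifted by
  -- one. Since X 0 = X 1 = 0, the run starts at the minimizer, where H contributes nothing.
  set w : ℕ → EuclideanSpace ℝ (Fin d) := fun k => (-(R k / α)) • e with hw
  have hR0 : ∀ k ∉ Finset.range (N + 2), R k = 0 := by
    intro k hk
    have hk : N + 2 ≤ k := by simpa using hk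
    simp [hR, hXN k hk, hXN (k + 1) (by omega), hXN (k + 2) (by omega)]
  have hwn : ∀ k, ‖w k‖ ^ 2 = R k ^ 2 / α ^ 2 := by
    intro k
    rw [hw, norm_smul, mul_pow, hne, mul_one, norm_neg, Real.norm_eq_abs, sq_abs, div_pow]
  have hw0 : ∀ k ∉ Finset.range (N + 2), ‖w k‖ ^ 2 = 0 := fun k hk => by
    rw [hwn, hR0 k hk]; simp
  have hstate : ∀ k, (gmmState (quadObjective Q p r) α β ν w (xs, xs) k).1 = xs + X (k + 1) • e ∧
      (gmmState (quadObjective Q p r) α β ν w (xs, xs) k).2 = xs + X k • e := by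
    intro k
    induction k with
    | zero => simp [gmmState, hX0, hX1]
    | succ k ih =>
      refine ⟨?_, by rw [← ih.1]; rfl⟩
      rw [← sub_eq_iff_eq_add']
      refine WithLp.ofLp_injective 2 ?_
      rw [gmmState_succ_fst hQ hxs α β ν w _ k ih.1 ih.2]
      simp only [WithLp.ofLp_smul, Matrix.mulVec_smul, hQe, hw, hR, smul_smul, ← sub_smul,
        ← add_smul, hb, hc, bCoef, cCoef]
      congr 1
      field_simp
      ring
  have hval : ∀ k, quadObjective Q p r (gmmState (quadObjective Q p r) α β ν w (xs, xs) k).1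
      - quadObjective Q p r xs = lam i / 2 * X (k + 1) ^ 2 := by
    intro k
    rw [quadObjective_sub hU hdec hQ hxs, (hstate k).1, add_sub_cancel_left]
    simp only [WithLp.ofLp_smul, Matrix.mulVec_smul, hUe]
    rw [Finset.sum_eq_single i (fun j _ hj => by simp [hj]) (by simp)]
    simp
  obtain ⟨-, hle⟩ := hall (xs, xs) w (summable_of_ne_finset_zero hw0)
  simp only [hval] at hle
  rw [hH, tsum_eq_sum (s := Finset.range (N + 2)) (fun k hk => by
      rw [hXN (k + 1) (by have : N + 2 ≤ k := by simpa using hk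
                          omega)]; simp), tsum_eq_sum hw0] at hle
  simp only [hwn] at hle
  rw [← Finset.mul_sum, ← Finset.sum_div, NNReal.coe_zero, add_zero, ← mul_div_assoc,
    le_div_iff₀ (by positivity)] at hle
  linarith

/-! ### Stability conditions and the closed form. -/

/-- The Jury conditions for a real quadratic with all roots in the open unit disk. -/
theorem jury_of_roots {b c : ℝ} (hroots : ∀ z : ℂ, z ^ 2 + b * z + c = 0 → ‖z‖ < 1) :
    c < 1 ∧ |b| < 1 + c := by
  have hreal : ∀ x : ℝ, x ^ 2 + b * x + c = 0 → |x| < 1 := by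
    intro x hx
    have := hroots x (by exact_mod_cast hx)
    simpa using this
  -- If x² + σ b x + c is nonpositive at x = 1, its larger real root is at least 1; multiplied by σ,
  -- it is a root of the original quadratic.
  have hneg : ∀ σ : ℝ, σ ^ 2 = 1 → 0 < 1 + σ * b + c := by
    intro σ hσ
    by_contra! h
    have hdisc : (σ * b + 2) ^ 2 ≤ b ^ 2 - 4 * c := by
      have : (σ * b + 2) ^ 2 = b ^ 2 + 4 * (σ * b) + 4 := by linear_combination b ^ 2 * hσ
      linarith
    have h0 : 0 ≤ b ^ 2 - 4 * c := (sq_nonneg _).trans hdisc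
    have h1 : σ * b + 2 ≤ √(b ^ 2 - 4 * c) :=
      (le_abs_self _).trans (Real.abs_le_sqrt hdisc)
    have h2 := Real.sq_sqrt h0
    have h3 := hreal (σ * ((-(σ * b) + √(b ^ 2 - 4 * c)) / 2)) (by
      linear_combination (1 / 4 : ℝ) * σ ^ 2 * h2
        + (σ ^ 2 * b ^ 2 / 4 - σ * b * √(b ^ 2 - 4 * c) / 2 - c) * hσ)
    have h4 : |σ| = 1 := by rw [← sq_abs] at hσ; nlinarith [abs_nonneg σ]
    rw [abs_mul, h4, one_mul] at h3
    have := (abs_lt.1 h3).2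
    linarith
  refine ⟨?_, ?_⟩
  · obtain ⟨s, hs⟩ := IsAlgClosed.exists_pow_nat_eq ((b : ℂ) ^ 2 - 4 * c) (n := 2) (by norm_num)
    have h₁ := hroots ((-b + s) / 2) (by linear_combination (1 / 4 : ℂ) * hs)
    have h₂ := hroots ((-b - s) / 2) (by linear_combination (1 / 4 : ℂ) * hs)
    have hprod : ((-b + s) / 2) * ((-b - s) / 2) = (c : ℂ) := by
      linear_combination (-1 / 4 : ℂ) * hs
    have h3 := congrArg norm hprod
    rw [norm_mul, Complex.norm_real] at h3
    have h4 := mul_lt_one_of_nonneg_of_lt_one_left (norm_nonneg _) h₁ h₂.le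
    rw [h3] at h4
    exact (le_abs_self c).trans_lt h4
  · have h1 := hneg 1 (by norm_num)
    have h2 := hneg (-1) (by norm_num)
    rw [abs_lt]
    constructor <;> linarith

theorem posDef_eigen_pos {d : ℕ} {Q U : Matrix (Fin d) (Fin d) ℝ} {lam : Fin d → ℝ}
    (hQ : Q.PosDef) (hU : U ∈ Matrix.orthogonalGroup (Fin d) ℝ)
    (hdec : Q = U * Matrix.diagonal lam * Uᵀ) (i : Fin d) : 0 < lam i := by
  have h := hQ.conjTranspose_mul_mul_same (B := U) (Matrix.mulVec_injective_of_isUnit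
    (IsUnit.of_mul_eq_one Uᵀ (orthogonal_mul_transpose hU)))
  have e : Uᴴ * Q * U = Matrix.diagonal lam := by
    rw [Matrix.conjTranspose_eq_transpose_of_trivial, hdec, ← mul_assoc, ← mul_assoc,
      orthogonal_transpose_mul hU, one_mul, mul_assoc, orthogonal_transpose_mul hU, mul_one]
  rw [e, Matrix.posDef_diagonal_iff] at h
  exact h i

section Coefficients

variable {α β ν μ L lam : ℝ}

/-- The worst mode of GMM is an extreme eigenvalue. -/
theorem le_mul_rCoef_sq_of_endpoints (hα : 0 < α) (hν : 0 ≤ ν) (hμ : 0 < μ) (h₁ : μ ≤ lam)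
    (h₂ : lam ≤ L) (hcμ : cCoef α β ν μ < 1) (hbμ : |bCoef α β ν μ| < 1 + cCoef α β ν μ)
    (hcL : cCoef α β ν L < 1) (hbL : |bCoef α β ν L| < 1 + cCoef α β ν L)
    (t : ℝ) (ht : t ∈ Set.Icc (-1 : ℝ) 1) :
    lam ≤ max (√μ / rCoef α β ν μ) (√L / rCoef α β ν L) ^ 2 *
      symbolSq (bCoef α β ν lam) (cCoef α β ν lam) t := by
  obtain ⟨hrμ, ⟨τ, σ, c₁, c₂, c₃, hcertμ⟩, -⟩ := rCoef_spec rfl rfl hcμ hbμ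
  obtain ⟨hrL, ⟨τ', σ', c₁', c₂', c₃', hcertL⟩, -⟩ := rCoef_spec rfl rfl hcL hbL
  set M := max (√μ / rCoef α β ν μ) (√L / rCoef α β ν L) with hM
  have hL : 0 < L := hμ.trans_le (h₁.trans h₂)
  have hM0 : 0 < M := lt_max_of_lt_left (div_pos (Real.sqrt_pos.2 hμ) hrμ)
  have hMμ : μ ≤ M ^ 2 * rCoef α β ν μ ^ 2 := by
    have h : √μ ≤ M * rCoef α β ν μ := (div_le_iff₀ hrμ).1 (le_max_left _ _)
    rw [← mul_pow]
    exact (Real.sqrt_le_left (by positivity)).1 h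
  have hML : L ≤ M ^ 2 * rCoef α β ν L ^ 2 := by
    have h : √L ≤ M * rCoef α β ν L := (div_le_iff₀ hrL).1 (le_max_right _ _)
    rw [← mul_pow]
    exact (Real.sqrt_le_left (by positivity)).1 h
  -- With s = αλ and κ = 1/(α M²), the bound κ s ≤ W reads λ ≤ M² W.
  have key := mul_le_symbolSq_of_endpoints (β := β) (ν := ν) (s₁ := α * μ) (s₂ := α * L)
    (s := α * lam) (κ := 1 / (α * M ^ 2)) hν (mul_pos hα hμ) (by gcongr) (by gcongr) hcμ (by
      have := (abs_lt.1 hbL).2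
      simp only [bCoef, cCoef] at this
      linarith)
    (fun t ht => by
      refine le_trans ?_ (hcertμ.le ht)
      rw [div_mul_eq_mul_div, one_mul, div_le_iff₀ (by positivity)]
      nlinarith)
    (fun t ht => by
      refine le_trans ?_ (hcertL.le ht)
      rw [div_mul_eq_mul_div, one_mul, div_le_iff₀ (by positivity)]
      nlinarith) ht
  rw [div_mul_eq_mul_div, one_mul, div_le_iff₀ (by positivity)] at key
  change α * lam ≤ symbolSq (bCoef α β ν lam) (cCoef α β ν lam) t * _ at key
  refine le_of_mul_le_mul_left ?_ hα
  linarith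

/-- The minimum r_λ² is at most the symbol at t = 1 and at t = -1, where it is (αλ)² and (1 + c -
b)². -/
theorem rCoef_le (hα : 0 < α) (hlam : 0 < lam) (hc : cCoef α β ν lam < 1)
    (hb : |bCoef α β ν lam| < 1 + cCoef α β ν lam) :
    rCoef α β ν lam ≤ α * lam ∧ rCoef α β ν lam ≤ 1 + cCoef α β ν lam - bCoef α β ν lam := by
  obtain ⟨hr, ⟨τ, σ, c₁, c₂, c₃, hcert⟩, -⟩ := rCoef_spec rfl rfl hc hb
  have h1 := hcert.le (t := 1) (by norm_num)
  have h2 := hcert.le (t := -1) (by norm_num)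
  refine ⟨le_of_sq_le_sq (h1.trans_eq ?_) (by positivity),
    le_of_sq_le_sq (h2.trans_eq ?_) (by linarith [(abs_lt.1 hb).2])⟩
  · simp only [symbolSq, bCoef, cCoef]; ring
  · simp only [symbolSq]; ring

/-- S₁ says that the symbol of μ is smallest at an endpoint, t = 1 or t = -1. Given S₂, the endpoint
must be t = 1, where the minimum is (αμ)². -/
theorem mul_le_rCoef_iff (hα : 0 < α) (hν : 0 ≤ ν) (hμ : 0 < μ) (hμL : μ ≤ L)
    (hcμ : cCoef α β ν μ < 1) (hbμ : |bCoef α β ν μ| < 1 + cCoef α β ν μ)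
    (hcL : cCoef α β ν L < 1) (hbL : |bCoef α β ν L| < 1 + cCoef α β ν L) :
    (α * μ ≤ rCoef α β ν μ ∧ α * √(L * μ) ≤ rCoef α β ν L) ↔
      (α, β, ν) ∈ setS₁ μ ∩ setS₂ μ L := by
  refine and_congr_left fun hS₂ => ?_
  have hs : 1 + cCoef α β ν μ + bCoef α β ν μ = α * μ := by simp only [bCoef, cCoef]; ring
  have h1c : 0 < 1 + cCoef α β ν μ := (abs_nonneg _).trans_lt hbμ
  have habs : |bCoef α β ν μ * (1 + cCoef α β ν μ)| = |bCoef α β ν μ| * (1 + cCoef α β ν μ) := by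
    rw [abs_mul, abs_of_pos h1c]
  constructor
  · intro h
    by_contra hS
    simp only [setS₁, Set.mem_ofPred_eq, not_or, not_le, habs] at hS
    obtain ⟨hc0, hlt⟩ := hS
    rw [abs_of_pos hc0] at hlt
    obtain ⟨hr, -, -⟩ := rCoef_spec rfl rfl hcμ hbμ
    have hle : (α * μ) ^ 2 ≤ rCoef α β ν μ ^ 2 := pow_le_pow_left₀ (by positivity) h 2
    rw [rCoef, if_pos ⟨hc0, (div_lt_one (by positivity)).2 hlt⟩] at hr hle
    have hpos : 0 < 1 - bCoef α β ν μ ^ 2 / (4 * cCoef α β ν μ) := by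
      by_contra! h0
      rw [Real.sqrt_eq_zero_of_nonpos h0, mul_zero] at hr
      exact hr.false
    rw [← hs, mul_pow, sq_abs, Real.sq_sqrt hpos.le] at hle
    set b := bCoef α β ν μ
    set c := cCoef α β ν μ
    have e : (1 + c + b) ^ 2 - (1 - c) ^ 2 * (1 - b ^ 2 / (4 * c))
        = (4 * c + b * (1 + c)) ^ 2 / (4 * c) := by
      field_simp; ring
    have hne : 0 < 4 * c + b * (1 + c) := by
      nlinarith [neg_abs_le b]
    have : 0 < (4 * c + b * (1 + c)) ^ 2 / (4 * c) := by positivity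
    linarith
  · intro hS
    simp only [setS₁, Set.mem_ofPred_eq, habs] at hS
    have hnot : ¬ (0 < cCoef α β ν μ ∧
        |bCoef α β ν μ| * (1 + cCoef α β ν μ) / (4 * cCoef α β ν μ) < 1) := by
      rintro ⟨hc0, hlt⟩
      rw [div_lt_one (by positivity)] at hlt
      rw [abs_of_pos hc0] at hS
      rcases hS with h | h <;> linarith
    have hr : rCoef α β ν μ = 1 + cCoef α β ν μ - |bCoef α β ν μ| := by
      rw [rCoef, if_neg hnot, abs_of_pos h1c, abs_of_pos (by linarith)]
    rcases le_or_gt (bCoef α β ν μ) 0 with hb | hb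
    · rw [hr, abs_of_nonpos hb]
      linarith
    -- If b_μ > 0, then αμ ≤ α√(Lμ) ≤ r_L ≤ 1 + c_L - b_L ≤ 1 + c_μ - b_μ < 1 + c_μ + b_μ = αμ.
    · exfalso
      have h1 := (rCoef_le hα (hμ.trans_le hμL) hcL hbL).2
      have h2 : 1 + cCoef α β ν L - bCoef α β ν L ≤ 1 + cCoef α β ν μ - bCoef α β ν μ := by
        simp only [bCoef, cCoef]
        have : α * μ ≤ α * L := by gcongr
        nlinarith
      have h3 : μ ≤ √(L * μ) := Real.le_sqrt_of_sq_le (by nlinarith)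
      have h4 : α * μ ≤ α * √(L * μ) := by gcongr
      linarith

/-- The mode μ alone gives the lower bound. Equality means the maximum is at most 1/(α√μ), a
condition on each of its two entries. -/
theorem gain_eq_iff (hα : 0 < α) (hμ : 0 < μ) (hL : 0 < L) (hrμ : 0 < rCoef α β ν μ)
    (hrL : 0 < rCoef α β ν L) (hle : rCoef α β ν μ ≤ α * μ) :
    1 / √(2 * μ) ≤ α / √2 * max (√μ / rCoef α β ν μ) (√L / rCoef α β ν L) ∧
    (α / √2 * max (√μ / rCoef α β ν μ) (√L / rCoef α β ν L) = 1 / √(2 * μ) ↔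
      α * μ ≤ rCoef α β ν μ ∧ α * √(L * μ) ≤ rCoef α β ν L) := by
  have hsμ : 0 < √μ := Real.sqrt_pos.2 hμ
  have h2 : (0 : ℝ) < √2 := by positivity
  set M := max (√μ / rCoef α β ν μ) (√L / rCoef α β ν L) with hM
  have e1 : 1 / √(2 * μ) = 1 / √2 * (1 / √μ) := by
    rw [Real.sqrt_mul (by norm_num)]; field_simp
  have e2 : α / √2 * M = 1 / √2 * (α * M) := by ring
  have hμM : M ≤ 1 / (α * √μ) ↔ α * μ ≤ rCoef α β ν μ ∧ α * √(L * μ) ≤ rCoef α β ν L := by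
    rw [hM, max_le_iff, div_le_div_iff₀ hrμ (by positivity), div_le_div_iff₀ hrL (by positivity),
      one_mul, one_mul, Real.sqrt_mul hL.le]
    have : √μ * (α * √μ) = α * μ := by
      rw [mul_left_comm, Real.mul_self_sqrt hμ.le]
    rw [this, mul_left_comm]
  have hlow : 1 / √μ ≤ α * M := by
    refine le_trans ?_ (mul_le_mul_of_nonneg_left (le_max_left _ _) hα.le)
    rw [← mul_div_assoc, div_le_div_iff₀ hsμ hrμ, one_mul, mul_assoc, Real.mul_self_sqrt hμ.le]
    exact hle
  have hiff : α * M ≤ 1 / √μ ↔ M ≤ 1 / (α * √μ) := by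
    rw [le_div_iff₀ hsμ, le_div_iff₀ (by positivity)]
    constructor <;> intro h <;> linarith
  rw [e1, e2, ← hμM, ← hiff]
  refine ⟨mul_le_mul_of_nonneg_left hlow (by positivity), ?_⟩
  rw [mul_right_inj' (by positivity)]
  exact ⟨fun h => h.le, fun h => le_antisymm h hlow⟩

end Coefficients


/-! ### The main theorem. -/

theorem theorem1 (d : ℕ) (Q : Matrix (Fin d) (Fin d) ℝ) (hQ : Q.PosDef)
    (p : EuclideanSpace ℝ (Fin d)) (r : ℝ)
    -- the minimizer of the quadratic
    (xs : EuclideanSpace ℝ (Fin d)) (hxs : IsMinOn (quadObjective Q p r) Set.univ xs)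
    -- an eigenvalue decomposition `Q = U Λ Uᵀ`
    (U : Matrix (Fin d) (Fin d) ℝ) (hU : U ∈ Matrix.orthogonalGroup (Fin d) ℝ)
    (lam : Fin d → ℝ) (hdec : Q = U * Matrix.diagonal lam * Uᵀ)
    -- the smallest and the largest eigenvalue of `Q`
    (μ L : ℝ) (hμ : IsLeast (spectrum ℝ Q) μ) (hL : IsGreatest (spectrum ℝ Q) L)
    (α β ν : ℝ) (hα : 0 < α) (hβ : 0 ≤ β) (hν : 0 ≤ ν)
    (hρ : spectralRadius ℂ ((gmmA Q α β ν).map Complex.ofReal) < 1) :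
    -- the `ℓ₂` gain is the `H_∞` norm, and the supremum that defines the latter is attained
    l2Gain (quadObjective Q p r) xs α β ν =
        hInfNorm (gmmA Q α β ν) (gmmB d α) (gmmT U lam) ∧
    (∃ z : ℂ, ‖z‖ = 1 ∧ hInfNorm (gmmA Q α β ν) (gmmB d α) (gmmT U lam) =
        ENNReal.ofReal (spectralNorm₂
          (transferMatrix (gmmA Q α β ν) (gmmB d α) (gmmT U lam) z))) ∧
    -- the closed form
    l2Gain (quadObjective Q p r) xs α β ν =
        ENNReal.ofReal (α / √2 * max (√μ / rCoef α β ν μ) (√L / rCoef α β ν L)) ∧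
    -- the quantities in the closed form are well defined
    0 < rCoef α β ν μ ∧ 0 < rCoef α β ν L ∧
    -- the lower bound and the case of equality
    ENNReal.ofReal (1 / √(2 * μ)) ≤ l2Gain (quadObjective Q p r) xs α β ν ∧
    (l2Gain (quadObjective Q p r) xs α β ν = ENNReal.ofReal (1 / √(2 * μ)) ↔
      (α, β, ν) ∈ setS₁ μ ∩ setS₂ μ L) := by
  have hQt : Qᵀ = Q := by
    have := hQ.isHermitian.eq
    rwa [Matrix.conjTranspose_eq_transpose_of_trivial] at this
  have hstat := quadObjective_stationary hQt hxs
  have hspec := spectrum_eq_range hU hdec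
  rw [hspec] at hμ hL
  obtain ⟨i₁, hi₁⟩ := hμ.1
  obtain ⟨i₂, hi₂⟩ := hL.1
  have hlam : ∀ i, 0 < lam i := posDef_eigen_pos hQ hU hdec
  have hμ0 : 0 < μ := hi₁ ▸ hlam i₁
  have hμi : ∀ i, μ ≤ lam i := fun i => hμ.2 ⟨i, rfl⟩
  have hLi : ∀ i, lam i ≤ L := fun i => hL.2 ⟨i, rfl⟩
  have hμL : μ ≤ L := (hμi i₁).trans (hLi i₁)
  have hL0 : 0 < L := hμ0.trans_le hμL
  have hroots := fun i (z : ℂ) => norm_lt_one_of_root hU hdec hρ i (z := z)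
  have hjury := fun i => jury_of_roots (hroots i)
  have hspecr := fun i => rCoef_spec rfl rfl (hjury i).1 (hjury i).2
  have hjμ := hi₁ ▸ hjury i₁
  have hjL := hi₂ ▸ hjury i₂
  have hrμ : 0 < rCoef α β ν μ := hi₁ ▸ (hspecr i₁).1
  have hrL : 0 < rCoef α β ν L := hi₂ ▸ (hspecr i₂).1
  have hend := fun i => le_mul_rCoef_sq_of_endpoints hα hν hμ0 (hμi i) (hLi i) hjμ.1 hjμ.2
    hjL.1 hjL.2
  obtain ⟨hlow, hiff⟩ := gain_eq_iff hα hμ0 hL0 hrμ hrL (rCoef_le hα hμ0 hjμ.1 hjμ.2).1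
  rw [mul_le_rCoef_iff hα hν hμ0 hμL hjμ.1 hjμ.2 hjL.1 hjL.2] at hiff
  set M := max (√μ / rCoef α β ν μ) (√L / rCoef α β ν L) with hM
  have hM0 : 0 < M := lt_max_of_lt_left (div_pos (Real.sqrt_pos.2 hμ0) hrμ)
  set Γ := α / √2 * M with hΓ
  have hΓ0 : 0 < Γ := by positivity
  have hΓsq : Γ ^ 2 = α ^ 2 / 2 * M ^ 2 := by
    rw [hΓ, mul_pow, div_pow, Real.sq_sqrt (by norm_num)]
  obtain ⟨i, hiM⟩ : ∃ i, √(lam i) / rCoef α β ν (lam i) = M := by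
    rcases max_choice (√μ / rCoef α β ν μ) (√L / rCoef α β ν L) with h | h
    · exact ⟨i₁, by rw [hi₁, hM, h]⟩
    · exact ⟨i₂, by rw [hi₂, hM, h]⟩
  -- This mode and the point t minimizing its symbol serve twice: for the lower bound on the ℓ₂ gain
  -- and for the z attaining the H∞ norm.
  obtain ⟨hri, -, t, ht, hti⟩ := hspecr i
  have hgain : l2Gain (quadObjective Q p r) xs α β ν = ENNReal.ofReal Γ := by
    refine le_antisymm (iInf₂_le (Real.toNNReal Γ) ?_) (le_iInf₂ fun γ hγ => ?_)
    · refine hasL2GainLE_of_modes hU hdec hQt hstat hlam hroots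
        (ρ := fun j => rCoef α β ν (lam j) ^ 2) (fun j => pow_pos (hspecr j).1 2)
        (fun j => (hspecr j).2.1) _ fun j => ?_
      obtain ⟨-, -, s, hs, hsj⟩ := hspecr j
      have h := hend j s hs
      rw [hsj] at h
      rw [Real.coe_toNNReal _ hΓ0.le, hΓsq]
      nlinarith [sq_nonneg α]
    · have h := hγ.mode_le hU hdec hQt hstat hα i ht
      rw [hti] at h
      refine ENNReal.ofReal_le_of_le_toReal ?_
      rw [ENNReal.coe_toReal]
      refine le_of_sq_le_sq ?_ γ.coe_nonneg
      rw [hΓsq, ← hiM, div_pow, Real.sq_sqrt (hlam i).le, ← mul_div_assoc,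
        div_le_iff₀ (by positivity)]
      linarith
  have hterm : ∀ z : ℂ, ‖z‖ = 1 → z.re ∈ Set.Icc (-1 : ℝ) 1 := fun z hz =>
    abs_le.1 (hz ▸ Complex.abs_re_le_norm z)
  have hupper : hInfNorm (gmmA Q α β ν) (gmmB d α) (gmmT U lam) ≤ ENNReal.ofReal Γ := by
    refine iSup₂_le fun z hz => ENNReal.ofReal_le_ofReal ?_
    rw [spectralNorm₂_transferMatrix_gmm hU hdec hρ hz,
      pi_norm_le_iff_of_nonneg hΓ0.le]
    intro j
    obtain ⟨hrj, ⟨τ, σ, c₁, c₂, c₃, hcert⟩, -⟩ := hspecr j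
    have hpos := (pow_pos hrj 2).trans_le (hcert.le (hterm z hz))
    rw [Real.norm_of_nonneg (by positivity), hΓ]
    gcongr
    rw [div_le_iff₀ (Real.sqrt_pos.2 hpos), ← Real.sqrt_sq hM0.le, ← Real.sqrt_mul (sq_nonneg M)]
    exact Real.sqrt_le_sqrt (hend j _ (hterm z hz))
  obtain ⟨z, hz, hzt⟩ := exists_norm_eq_one_re ht
  have hattain : ENNReal.ofReal Γ ≤ ENNReal.ofReal (spectralNorm₂
      (transferMatrix (gmmA Q α β ν) (gmmB d α) (gmmT U lam) z)) := by
    refine ENNReal.ofReal_le_ofReal ?_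
    rw [spectralNorm₂_transferMatrix_gmm hU hdec hρ hz]
    refine le_trans ?_ (norm_le_pi_norm _ i)
    rw [hzt, hti, Real.sqrt_sq hri.le, hiM]
    exact le_abs_self _
  have hle : ENNReal.ofReal (spectralNorm₂
      (transferMatrix (gmmA Q α β ν) (gmmB d α) (gmmT U lam) z)) ≤
      hInfNorm (gmmA Q α β ν) (gmmB d α) (gmmT U lam) :=
    le_iSup₂ (f := fun (z : ℂ) (_ : ‖z‖ = 1) => ENNReal.ofReal (spectralNorm₂
      (transferMatrix (gmmA Q α β ν) (gmmB d α) (gmmT U lam) z))) z hz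
  have hinf : hInfNorm (gmmA Q α β ν) (gmmB d α) (gmmT U lam) = ENNReal.ofReal Γ :=
    le_antisymm hupper (hattain.trans hle)
  refine ⟨hgain.trans hinf.symm, ⟨z, hz, le_antisymm (hupper.trans hattain) hle⟩, hgain, hrμ, hrL,
    ?_, ?_⟩
  · rw [hgain]
    exact ENNReal.ofReal_le_ofReal hlow
  · rw [hgain, ENNReal.ofReal_eq_ofReal_iff hΓ0.le (by positivity)]
    exact hiff
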